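/- Let $n\in\{2,3\}$, let $\Omega\subset\mathbb R^n$ be a polyhedral domain (nonempty, bounded, open and connected, with boundary a finite union of nondegenerate $(n-1)$-simplices), let $r\ge 1$, and let $\mathbf a\in C^1(\bar\Omega;\mathbb R^n)$, $b,f\in C(\bar\Omega)$ satisfy $|\mathbf a|>0$, $b\ge 0$ and $b+\frac12\operatorname{div}\mathbf a\ge 0$ on $\bar\Omega$. For every $\sigma>0$ there is a constant $C>0$, depending only on $n,r,\Omega,\mathbf a,b,f,\sigma$, such that the following holds. Let $0<\varepsilon\le 1$ and let $u\in H^1_0(\Omega)$ be the weak solution of $-\varepsilon\Delta u+\operatorname{div}(\mathbf a u)+bu=f$ in $\Omega$, $u=0$ on $\partial\Omega$. Let $\mathcal T$ be a conforming simplicial partition of $\Omega$ which is shape-regular with constant $\sigma$, i.e. each $T\in\mathcal T$, of diameter $h_T$, contains a ball of radius $h_T/\sigma$. Let $S_h$ be the space of functions that are continuous on $\bar\Omega$, vanish on $\partial\Omega$, and are polynomials of degree at most $r$ on each $T\in\mathcal T$. Put $\underline h=\min_{T\in\mathcal T}h_T$, $\ell_h=1+\ln(2+\varepsilon\underline h^{-1})+|\ln\varepsilon|$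 and $\alpha_T=\min\{1,\ell_h\varepsilon^{-1}h_T^2\}$. Let $u_h\in S_h$ be arbitrary and $T\in\mathcal T$. Put $e=u-u_h$ and $R_h=-\varepsilon\Delta u_h+\operatorname{div}(\mathbf a u_h)+bu_h-f$ in $T$; let $R_{h,T}$ be the $L_2(T)$-orthogonal projection of $R_h$ onto the space $\mathbb P^{r-1}(T)$ of polynomials of degree at most $r-1$, and let $b_T=\prod_{i=1}^{n+1}\lambda_i^2$, where $\lambda_1,\dots,\lambda_{n+1}$ are the barycentric coordinates of $T$. Define $$|\mathbf a\cdot\nabla e|_{*;T}=\alpha_T\sup\Bigl\{\Bigl|\int_T b_T\,\psi\,\mathbf a\cdot\nabla e\Bigr| : \psi\in\mathbb P^{r-1}(T),\ \|\psi\|_{L_1(T)}=1\Bigr\}.$$ Then, with norms in $L_\infty(T)$, where $\|e\|_{\infty;T}$ is allowed to be $+\infty$, $$\alpha_T\|R_h\|_{\infty;T}\le C\bigl(\ell_h\|e\|_{\infty;T}+|\mathbf a\cdot\nabla e|_{*;T}+\alpha_T\|R_h-R_{h,T}\|_{\infty;T}\bigr),$$ $$|\mathbf a\cdot\nabla e|_{*;T}\le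 C\bigl(\ell_h\|e\|_{\infty;T}+\alpha_T\|R_h\|_{\infty;T}\bigr).$$ -/

import Mathlib

open MeasureTheory Filter Topology
open scoped ENNReal ContDiff RealInnerProductSpace

namespace ConvDiff

noncomputable section

/-- Euclidean `n`-space. -/
abbrev Pt (n : ℕ) : Type := EuclideanSpace ℝ (Fin n)

/-- A nondegenerate `n`-simplex in `ℝⁿ`, given by its `n + 1` affinely independent vertices.
The functions `T.coord i` are its barycentric coordinates. -/
abbrev Simp (n : ℕ) : Type := AffineBasis (Fin (n + 1)) ℝ (Pt n)

variable {n : ℕ}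

/-! ### Domains, simplices and meshes -/

/-- A polyhedral domain: a nonempty bounded connected open set whose boundary is the union of
finitely many nondegenerate `(n - 1)`-simplices. -/
structure IsPolyhedralDomain (Ω : Set (Pt n)) : Prop where
  isOpen : IsOpen Ω
  nonempty : Ω.Nonempty
  connected : IsPreconnected Ω
  bounded : Bornology.IsBounded Ω
  boundary : ∃ F : Set (Fin n → Pt n), F.Finite ∧ (∀ s ∈ F, AffineIndependent ℝ s) ∧
    frontier Ω = ⋃ s ∈ F, convexHull ℝ (Set.range s)

/-- The closed simplex spanned by the vertices. -/
def cell (T : Simp n) : Set (Pt n) := convexHull ℝ (Set.range T)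

/-- The diameter `h_T` of a simplex. -/
def cellDiam (T : Simp n) : ℝ := Metric.diam (cell T)

/-- Lebesgue measure on a simplex. -/
def cellMeasure (T : Simp n) : Measure (Pt n) := volume.restrict (cell T)

/-- A conforming simplicial partition of `Ω`: finitely many simplices, with interiors inside `Ω`,
covering the closure of `Ω`; distinct simplices have distinct vertex sets and meet exactly in
the (possibly empty) face spanned by their common vertices. -/
structure IsMesh (Ω : Set (Pt n)) (𝒯 : Finset (Simp n)) : Prop where
  cover : ⋃ T ∈ 𝒯, cell T = closure Ω
  interior_subset : ∀ T ∈ 𝒯, interior (cell T) ⊆ Ω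
  distinct : ∀ T ∈ 𝒯, ∀ T' ∈ 𝒯, T ≠ T' → Set.range T ≠ Set.range T'
  conforming : ∀ T ∈ 𝒯, ∀ T' ∈ 𝒯, T ≠ T' →
    cell T ∩ cell T' = convexHull ℝ (Set.range T ∩ Set.range T')

/-- Shape regularity with constant `σ`: every simplex `T` contains a ball of radius `h_T / σ`. -/
def ShapeRegular (𝒯 : Finset (Simp n)) (σ : ℝ) : Prop :=
  ∀ T ∈ 𝒯, ∃ x, Metric.closedBall x (cellDiam T / σ) ⊆ cell T

/-- The minimal diameter of the simplices of a (nonempty) mesh. -/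
def minDiam (𝒯 : Finset (Simp n)) : ℝ := ⨅ T : {T // T ∈ 𝒯}, cellDiam T.1

/-! ### Polynomials -/

/-- Value of a polynomial in `n` variables at a point. -/
def peval (p : MvPolynomial (Fin n) ℝ) (x : Pt n) : ℝ := MvPolynomial.eval (fun i => x i) p

/-- The finite element space `S_h` of degree `r`: functions that are continuous, vanish on the
boundary, and are polynomials of degree at most `r` on each simplex. -/
structure IsFEFunction (Ω : Set (Pt n)) (𝒯 : Finset (Simp n)) (r : ℕ) (uh : Pt n → ℝ) :
    Prop where
  continuousOn : ContinuousOn uh (closure Ω)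
  boundary : ∀ x ∈ frontier Ω, uh x = 0
  poly : ∀ T ∈ 𝒯, ∃ p : MvPolynomial (Fin n) ℝ, p.totalDegree ≤ r ∧ ∀ x ∈ cell T, uh x = peval p x

/-- The bubble function `b_T = ∏ λ_i²` of a simplex. -/
def bubble (T : Simp n) (x : Pt n) : ℝ := ∏ i, (T.coord i x) ^ 2

/-! ### The boundary value problem -/

/-- Divergence of a differentiable vector field. -/
def divg (F : Pt n → Pt n) (x : Pt n) : ℝ :=
  ∑ i, fderiv ℝ F x (EuclideanSpace.single i 1) i

/-- `u ∈ H₀¹(Ω)` with weak gradient `g`: the pair `(u, g)` is a limit in `L²(Ω)` of pairs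
`(φ, ∇φ)` with `φ` smooth and compactly supported in `Ω`. -/
structure IsH10 (Ω : Set (Pt n)) (u : Pt n → ℝ) (g : Pt n → Pt n) : Prop where
  memLp : MemLp u 2 (volume.restrict Ω)
  memLp_grad : MemLp g 2 (volume.restrict Ω)
  approx : ∃ φ : ℕ → Pt n → ℝ,
    (∀ k, ContDiff ℝ ∞ (φ k) ∧ HasCompactSupport (φ k) ∧ tsupport (φ k) ⊆ Ω) ∧
    Tendsto (fun k => eLpNorm (fun x => φ k x - u x) 2 (volume.restrict Ω)) atTop (𝓝 0) ∧
    Tendsto (fun k => eLpNorm (fun x => gradient (φ k) x - g x) 2 (volume.restrict Ω))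
      atTop (𝓝 0)

/-- `u`, with weak gradient `g`, is the weak solution in `H₀¹(Ω)` of
`-ε Δu + div (a u) + b u = f` in `Ω`, `u = 0` on `∂Ω`. For `u ∈ H¹` the term `div (a u)` is
`a · ∇u + (div a) u`. -/
structure IsWeakSolution (Ω : Set (Pt n)) (ε : ℝ) (a : Pt n → Pt n) (b f : Pt n → ℝ)
    (u : Pt n → ℝ) (g : Pt n → Pt n) : Prop where
  isH10 : IsH10 Ω u g
  weak : ∀ v w, IsH10 Ω v w →
    ε * (∫ x in Ω, ⟪g x, w x⟫) + (∫ x in Ω, (⟪a x, g x⟫ + divg a x * u x + b x * u x) * v x)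
      = ∫ x in Ω, f x * v x

/-- The residual `R_h = -ε Δu_h + div (a u_h) + b u_h - f`, in the interior of each simplex. -/
def residual (ε : ℝ) (a : Pt n → Pt n) (b f uh : Pt n → ℝ) (x : Pt n) : ℝ :=
  -ε * Laplacian.laplacian uh x + divg (fun y => uh y • a y) x + b x * uh x - f x

/-! ### The `L²` projection onto polynomials -/

/-- `q` is the `L²(T)`-orthogonal projection of `w` onto polynomials of degree at most `k`. -/
def IsL2Projection (T : Simp n) (k : ℕ) (w : Pt n → ℝ) (q : MvPolynomial (Fin n) ℝ) : Prop :=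
  q.totalDegree ≤ k ∧ ∀ p : MvPolynomial (Fin n) ℝ, p.totalDegree ≤ k →
    ∫ x, (w x - peval q x) * peval p x ∂(cellMeasure T) = 0

theorem continuous_peval (p : MvPolynomial (Fin n) ℝ) : Continuous (peval p) := by
  unfold peval
  exact (MvPolynomial.continuous_eval p).comp (by fun_prop)

theorem isCompact_cell (T : Simp n) : IsCompact (cell T) :=
  (Set.finite_range T).isCompact_convexHull ℝ

theorem memLp_peval (T : Simp n) (p : MvPolynomial (Fin n) ℝ) :
    MemLp (peval p) 2 (cellMeasure T) := by
  have hc := isCompact_cell T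
  have : IsFiniteMeasure (cellMeasure T) := ⟨by
    simpa [cellMeasure] using hc.measure_lt_top⟩
  obtain ⟨C, hC⟩ := hc.exists_bound_of_continuousOn (continuous_peval p).continuousOn
  refine MemLp.of_bound (continuous_peval p).aestronglyMeasurable C ?_
  exact (ae_restrict_iff' hc.measurableSet).2 (ae_of_all _ hC)

/-- The linear map from polynomials of degree at most `k` to `L²(T)`. -/
def polyToLp (T : Simp n) (k : ℕ) :
    MvPolynomial.restrictTotalDegree (Fin n) ℝ k →ₗ[ℝ] Lp ℝ 2 (cellMeasure T) where
  toFun p := (memLp_peval T p.1).toLp _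
  map_add' p q := by
    rw [← MemLp.toLp_add]
    congr 1
    funext x
    simp [peval]
  map_smul' c p := by
    rw [RingHom.id_apply, ← MemLp.toLp_const_smul]
    congr 1
    funext x
    simp [peval]

theorem exists_isL2Projection (T : Simp n) (k : ℕ) {w : Pt n → ℝ}
    (hw : MemLp w 2 (cellMeasure T)) : ∃ q, IsL2Projection T k w q := by
  let K := LinearMap.range (polyToLp T k)
  obtain ⟨q, hq⟩ : K.starProjection (hw.toLp w) ∈ K := K.starProjection_apply_mem _
  refine ⟨q.1, (MvPolynomial.mem_restrictTotalDegree _ _ _).1 q.2, fun p hp => ?_⟩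
  let p' : MvPolynomial.restrictTotalDegree (Fin n) ℝ k :=
    ⟨p, (MvPolynomial.mem_restrictTotalDegree _ _ _).2 hp⟩
  have h := K.starProjection_inner_eq_zero (hw.toLp w) (polyToLp T k p') ⟨p', rfl⟩
  rw [← hq, L2.inner_def] at h
  rw [← h]
  refine integral_congr_ae ?_
  filter_upwards [Lp.coeFn_sub (hw.toLp w) (polyToLp T k q), hw.coeFn_toLp,
    (memLp_peval T q.1).coeFn_toLp, (memLp_peval T p).coeFn_toLp] with x h1 h2 h3 h4
  have h3' : (polyToLp T k q) x = peval q.1 x := h3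
  have h4' : (polyToLp T k p') x = peval p x := h4
  rw [h1, h4', Pi.sub_apply, h2, h3']
  simp [mul_comm]

open Classical in
/-- The `L²(T)`-orthogonal projection onto polynomials of degree at most `k`; it exists for every
`w ∈ L²(T)` by the previous lemma. -/
def l2Proj (T : Simp n) (k : ℕ) (w : Pt n → ℝ) : MvPolynomial (Fin n) ℝ :=
  if h : ∃ q, IsL2Projection T k w q then h.choose else 0

theorem l2Proj_spec (T : Simp n) (k : ℕ) {w : Pt n → ℝ} (hw : MemLp w 2 (cellMeasure T)) :
    IsL2Projection T k w (l2Proj T k w) := by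
  have h := exists_isL2Projection T k hw
  rw [l2Proj, dif_pos h]
  exact h.choose_spec

/-! ### Mesh-dependent quantities -/

/-- The logarithmic factor `ℓ_h = 1 + ln (2 + ε / min_T h_T) + |ln ε|`. -/
def logFactor (ε : ℝ) (𝒯 : Finset (Simp n)) : ℝ :=
  1 + Real.log (2 + ε / minDiam 𝒯) + |Real.log ε|

/-- The weight `α_T = min {1, ℓ_h ε⁻¹ h_T²}`. -/
def alphaW (ε : ℝ) (𝒯 : Finset (Simp n)) (T : Simp n) : ℝ :=
  min 1 (logFactor ε 𝒯 * ε⁻¹ * cellDiam T ^ 2)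

/-- The norm of `L^∞(T)`, with values in `[0, ∞]`. -/
def supNorm (T : Simp n) (w : Pt n → ℝ) : ℝ≥0∞ := eLpNorm w ∞ (cellMeasure T)

/-- For `w = a · ∇e`, the seminorm
`|w|_{*;T} = α_T sup { |∫_T b_T ψ w| : ψ ∈ ℙ^{r-1}(T), ‖ψ‖_{1;T} = 1 }`. -/
def starSeminorm (ε : ℝ) (𝒯 : Finset (Simp n)) (r : ℕ) (T : Simp n) (w : Pt n → ℝ) : ℝ≥0∞ :=
  ENNReal.ofReal (alphaW ε 𝒯 T) *
    ⨆ (ψ : MvPolynomial (Fin n) ℝ) (_ : ψ.totalDegree ≤ r - 1)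
      (_ : eLpNorm (peval ψ) 1 (cellMeasure T) = 1),
      ENNReal.ofReal |∫ x, bubble T x * peval ψ x * w x ∂(cellMeasure T)|

/-- The convective derivative `a · ∇(u - u_h)`, where `g` is the weak gradient of `u` and `u_h`
is differentiated inside each simplex. -/
def convError (a g : Pt n → Pt n) (uh : Pt n → ℝ) (x : Pt n) : ℝ :=
  ⟪a x, g x - gradient uh x⟫

end

end ConvDiff

namespace ConvDiff

noncomputable section

variable {n : ℕ}

/-! Both estimates come from one identity. For smooth `φ` with compact support inside `T`,
integrating by parts twice in the weak equation gives `∫ R_h φ + ∫ (a·∇e) φ = ε ∫ e Δφ - ∫ (div a +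
b) e φ`, so that `R_h` and `a·∇e` agree up to sign and up to terms that contain `e` without
derivatives.

The identity is wanted for `φ = b_T ψ`, with `ψ` a polynomial and `‖ψ‖_{L¹(T)} = 1`. Since `b_T`
vanishes to second order on `∂T`, each `λ_i²` can be replaced by `c⁻² s(c λ_i)`, where `s` is
smooth, vanishes on `(-∞, 1]` and equals `t²` on `[2, ∞)`. The second derivative of this cutoff is
bounded uniformly in `c`, so `h_T² ‖Δφ‖_{L¹}` stays bounded (`exists_integral_abs_lap_testFn_le`).
Letting `c → ∞` gives `|∫ b_T ψ R_h + ∫ b_T ψ a·∇e| ≤ (A ε h_T⁻² + 2 C_a) ‖e‖_∞`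
(`CellRegular.abs_integral_bubble_le`). The weight is chosen so that `α_T (A ε h_T⁻² + 2 C_a) ≤ C
ℓ_h` (`alphaW_mul_le`). The second estimate follows at once, because `0 ≤ b_T ≤ 1`.

For the first estimate put `q = R_{h,T}`, of which only the degree matters. Testing with `ψ = q /
‖q‖_{L¹}` recovers `‖q‖_∞` up to a constant (`exists_supNorm_peval_le`), and the triangle inequality
passes between `q` and `R_h` at the cost of `‖R_h - q‖_∞`.

The inverse estimates use no reference simplex. With `x₀` the centre of the inscribed ball, `T` lies
in the ball of radius `h_T` about `x₀`, and `b_T` is bounded below on the concentric ball of radius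
`h_T/(2σ)`. Hence it suffices to compare norms of polynomials on two concentric balls, which is
finite-dimensional norm equivalence and scaling (`exists_inverse_estimate`). -/

/-! ### Partial derivatives -/

/-- The `i`-th partial derivative. -/
def partialD (i : Fin n) (φ : Pt n → ℝ) (x : Pt n) : ℝ :=
  fderiv ℝ φ x (EuclideanSpace.single i 1)

/-- The sum of the pure second partial derivatives. -/
def lap (φ : Pt n → ℝ) (x : Pt n) : ℝ := ∑ i, partialD i (partialD i φ) x

/-! ### Polynomials of bounded degree -/

theorem contDiff_peval (p : MvPolynomial (Fin n) ℝ) : ContDiff ℝ ∞ (peval p) := by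
  induction p using MvPolynomial.induction_on with
  | C a =>
    have : peval (MvPolynomial.C a) = fun _ : Pt n => a := by funext x; simp [peval]
    rw [this]
    exact contDiff_const
  | add p q hp hq =>
    have : peval (p + q) = fun x : Pt n => peval p x + peval q x := by funext x; simp [peval]
    rw [this]
    exact hp.add hq
  | mul_X p i hp =>
    have hi : ContDiff ℝ ∞ (fun x : Pt n => x i) := by fun_prop
    have : peval (p * MvPolynomial.X i) = fun x : Pt n => peval p x * x i := by
      funext x; simp [peval]
    rw [this]
    exact hp.mul hi

theorem differentiable_peval (p : MvPolynomial (Fin n) ℝ) : Differentiable ℝ (peval p) :=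
  (contDiff_peval p).differentiable (by simp)

theorem partialD_peval (i : Fin n) (p : MvPolynomial (Fin n) ℝ) :
    partialD i (peval p) = peval (MvPolynomial.pderiv i p) := by
  induction p using MvPolynomial.induction_on with
  | C a =>
    have : peval (MvPolynomial.C a) = fun _ : Pt n => a := by funext x; simp [peval]
    funext x
    simp [partialD, this]
    simp [peval]
  | add p q hp hq =>
    have : peval (p + q) = peval p + peval q := by funext x; simp [peval]
    funext x
    have h1 := congrFun hp x
    have h2 := congrFun hq x
    rw [partialD] at h1 h2
    rw [partialD, this, fderiv_add (differentiable_peval p x) (differentiable_peval q x)]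
    rw [add_apply, h1, h2]
    simp [peval]
  | mul_X p j hp =>
    have hj : ∀ x, HasFDerivAt (fun x : Pt n => x j) (EuclideanSpace.proj j : Pt n →L[ℝ] ℝ) x :=
      fun x => (EuclideanSpace.proj j : Pt n →L[ℝ] ℝ).hasFDerivAt
    have : peval (p * MvPolynomial.X j) = fun x : Pt n => peval p x * x j := by
      funext x; simp [peval]
    funext x
    have h1 := congrFun hp x
    rw [partialD] at h1
    have h2 := ((differentiable_peval p x).hasFDerivAt.mul (hj x)).fderiv
    rw [show (peval p * fun y : Pt n => y j) = peval (p * MvPolynomial.X j) from this.symm] at h2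
    rw [partialD, h2]
    simp only [add_apply, smul_apply, smul_eq_mul, h1]
    by_cases hij : j = i
    · subst hij; simp [peval]
    · simp [peval, hij, MvPolynomial.pderiv_X_of_ne hij]

/-- The class of polynomials of degree at most `k` is stable under homotheties. -/
theorem exists_peval_homothety (p : MvPolynomial (Fin n) ℝ) (x₀ : Pt n) (h : ℝ) :
    ∃ q : MvPolynomial (Fin n) ℝ, q.totalDegree ≤ p.totalDegree ∧
      ∀ y, peval q y = peval p (x₀ + h • y) := by
  let L : Fin n → MvPolynomial (Fin n) ℝ := fun i =>
    MvPolynomial.C (x₀ i) + MvPolynomial.C h * MvPolynomial.X i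
  have hL : ∀ i, (L i).totalDegree ≤ 1 := fun i => by
    refine (MvPolynomial.totalDegree_add _ _).trans (max_le (by simp) ?_)
    exact (MvPolynomial.totalDegree_mul _ _).trans (by simp)
  refine ⟨MvPolynomial.bind₁ L p, ?_, fun y => ?_⟩
  · rw [MvPolynomial.bind₁, MvPolynomial.aeval_def, MvPolynomial.eval₂_eq]
    refine MvPolynomial.totalDegree_finsetSum_le fun m hm => ?_
    refine le_trans ?_ (MvPolynomial.le_totalDegree hm)
    refine (MvPolynomial.totalDegree_mul _ _).trans ?_
    rw [MvPolynomial.algebraMap_eq, MvPolynomial.totalDegree_C, zero_add]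
    refine (MvPolynomial.totalDegree_finsetProd _ _).trans ?_
    rw [Finsupp.sum]
    refine Finset.sum_le_sum fun i _ => (MvPolynomial.totalDegree_pow _ _).trans ?_
    simpa using Nat.mul_le_mul_left (m i) (hL i)
  · have := MvPolynomial.aeval_bind₁ (S := ℝ) (fun i => y i) L p
    rw [peval, peval, ← MvPolynomial.coe_aeval_eq_eval, ← MvPolynomial.coe_aeval_eq_eval]
    refine this.trans ?_
    have hLy : (fun i => (MvPolynomial.aeval fun i => y i) (L i)) = fun i => (x₀ + h • y) i := by
      funext i
      simp [L]
    rw [hLy]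
    rfl

/-- A polynomial which vanishes almost everywhere on a ball is zero. -/
theorem eq_zero_of_ae_ball {s : ℝ} (hs : 0 < s) {p : MvPolynomial (Fin n) ℝ}
    (h : ∀ᵐ x ∂(volume.restrict (Metric.ball (0 : Pt n) s)), peval p x = 0) : p = 0 := by
  have h0 : Set.EqOn (peval p) 0 (Metric.ball 0 s) :=
    Measure.eqOn_open_of_ae_eq (μ := volume) h Metric.isOpen_ball
      (continuous_peval p).continuousOn continuousOn_const
  have hnhds : (WithLp.toLp 2) ⁻¹' (Metric.ball (0 : Pt n) s) ∈ 𝓝 (0 : Fin n → ℝ) :=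
    (PiLp.continuous_toLp 2 _).continuousAt.preimage_mem_nhds
      (Metric.isOpen_ball.mem_nhds (by simpa using hs))
  obtain ⟨δ, hδ, hsub⟩ := Metric.mem_nhds_iff.1 hnhds
  -- The ball contains a product of intervals, and a polynomial vanishing on a product of infinite
  -- sets is zero.
  refine MvPolynomial.funext_set (fun _ => Metric.ball (0 : ℝ) δ) (fun _ => ?_) fun x hx => ?_
  · rw [Real.ball_eq_Ioo]
    exact Set.Ioo_infinite (by linarith)
  · have hx' : x ∈ Metric.ball (0 : Fin n → ℝ) δ := by
      rw [ball_pi _ hδ]; exact hx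
    simpa [peval] using h0 (hsub hx')

/-! ### Norm equivalence and inverse estimates on balls -/

/-- `G` factors through the range of `F`, which is finite-dimensional, and linear maps out of it are
continuous. This is the source of all the inverse estimates. -/
theorem norm_linearMap_le_of_injective {V A B : Type*} [AddCommGroup V] [Module ℝ V]
    [FiniteDimensional ℝ V] [NormedAddCommGroup A] [NormedSpace ℝ A] [NormedAddCommGroup B]
    [NormedSpace ℝ B] (F : V →ₗ[ℝ] A) (hF : Function.Injective F) (G : V →ₗ[ℝ] B) :
    ∃ K : ℝ, 0 < K ∧ ∀ v, ‖G v‖ ≤ K * ‖F v‖ := by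
  let e := LinearEquiv.ofInjective F hF
  let H : LinearMap.range F →L[ℝ] B := LinearMap.toContinuousLinearMap (G ∘ₗ e.symm.toLinearMap)
  refine ⟨‖H‖ + 1, by positivity, fun v => ?_⟩
  have h := H.le_opNorm (e v)
  have h1 : H (e v) = G v := by simp [H]
  have h2 : ‖e v‖ = ‖F v‖ := rfl
  rw [h1, h2] at h
  nlinarith [norm_nonneg (F v)]

theorem memLp_peval_ball (p : MvPolynomial (Fin n) ℝ) (s : ℝ) :
    MemLp (peval p) 2 (volume.restrict (Metric.ball (0 : Pt n) s)) := by
  have : IsFiniteMeasure (volume.restrict (Metric.ball (0 : Pt n) s)) :=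
    ⟨by simpa using measure_ball_lt_top⟩
  obtain ⟨C, hC⟩ := (isCompact_closedBall (0 : Pt n) s).exists_bound_of_continuousOn
    (continuous_peval p).continuousOn
  refine MemLp.of_bound (continuous_peval p).aestronglyMeasurable C ?_
  exact (ae_restrict_iff' measurableSet_ball).2
    (ae_of_all _ fun x hx => hC x (Metric.ball_subset_closedBall hx))

/-- Polynomials of degree at most `k` as elements of `L²` of a ball. -/
def polyToLpBall (k : ℕ) (s : ℝ) :
    MvPolynomial.restrictTotalDegree (Fin n) ℝ k →ₗ[ℝ]
      Lp ℝ 2 (volume.restrict (Metric.ball (0 : Pt n) s)) where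
  toFun p := (memLp_peval_ball p.1 s).toLp _
  map_add' p q := by
    rw [← MemLp.toLp_add]
    congr 1
    funext x
    simp [peval]
  map_smul' c p := by
    rw [RingHom.id_apply, ← MemLp.toLp_const_smul]
    congr 1
    funext x
    simp [peval]

theorem polyToLpBall_injective (k : ℕ) {s : ℝ} (hs : 0 < s) :
    Function.Injective (polyToLpBall (n := n) k s) := by
  rw [injective_iff_map_eq_zero]
  intro p hp
  have h1 := (memLp_peval_ball p.1 s).coeFn_toLp
  have h2 : (memLp_peval_ball p.1 s).toLp _ = 0 := hp
  rw [h2] at h1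
  refine Subtype.ext (eq_zero_of_ae_ball hs ?_)
  filter_upwards [h1, Lp.coeFn_zero ℝ 2 (volume.restrict (Metric.ball (0 : Pt n) s))] with x h3 h4
  rw [← h3, h4]
  rfl

theorem norm_polyToLpBall_sq (k : ℕ) (s : ℝ)
    (p : MvPolynomial.restrictTotalDegree (Fin n) ℝ k) :
    ‖polyToLpBall k s p‖ ^ 2 = ∫ x in Metric.ball (0 : Pt n) s, peval p.1 x ^ 2 := by
  rw [← real_inner_self_eq_norm_sq, L2.inner_def]
  refine integral_congr_ae ?_
  filter_upwards [(memLp_peval_ball p.1 s).coeFn_toLp] with x hx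
  have : (polyToLpBall k s p) x = peval p.1 x := hx
  rw [this]
  simp [sq]

/-- On polynomials of degree at most `k`, a linear operator is bounded from `L²` of a small ball
to the sup norm on the unit ball. -/
theorem exists_sq_le_integral_unit (k : ℕ) {s : ℝ} (hs : 0 < s)
    (P : MvPolynomial (Fin n) ℝ →ₗ[ℝ] MvPolynomial (Fin n) ℝ) :
    ∃ K : ℝ, 0 < K ∧ ∀ p : MvPolynomial (Fin n) ℝ, p.totalDegree ≤ k →
      ∀ y ∈ Metric.closedBall (0 : Pt n) 1,
        peval (P p) y ^ 2 ≤ K * ∫ x in Metric.ball (0 : Pt n) s, peval p x ^ 2 := by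
  have : CompactSpace (Metric.closedBall (0 : Pt n) 1) :=
    isCompact_iff_compactSpace.1 (isCompact_closedBall _ _)
  let G : MvPolynomial.restrictTotalDegree (Fin n) ℝ k →ₗ[ℝ]
      C(Metric.closedBall (0 : Pt n) 1, ℝ) :=
    { toFun := fun p =>
        ⟨fun y => peval (P p.1) y.1, (continuous_peval _).comp continuous_subtype_val⟩
      map_add' := fun p q => by ext y; simp [peval]
      map_smul' := fun c p => by ext y; simp [peval] }
  obtain ⟨K, hK, h⟩ := norm_linearMap_le_of_injective _ (polyToLpBall_injective k hs) G
  refine ⟨K ^ 2, by positivity, fun p hp y hy => ?_⟩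
  let p' : MvPolynomial.restrictTotalDegree (Fin n) ℝ k :=
    ⟨p, (MvPolynomial.mem_restrictTotalDegree _ _ _).2 hp⟩
  have h1 : |peval (P p) y| ≤ ‖G p'‖ := (G p').norm_coe_le_norm ⟨y, hy⟩
  rw [← norm_polyToLpBall_sq k s p', ← sq_abs, ← mul_pow]
  exact pow_le_pow_left₀ (abs_nonneg _) (h1.trans (h p')) 2

theorem partialD_comp_homothety (i : Fin n) (f : Pt n → ℝ) (x₀ : Pt n) (h : ℝ)
    (y : Pt n) :
    partialD i (fun z => f (x₀ + h • z)) y = h * partialD i f (x₀ + h • y) := by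
  have h1 : (fun z => f (x₀ + h • z)) = fun z => (fun w => f (x₀ + w)) (h • z) := rfl
  rw [partialD, h1, fderiv_comp_smul (f := fun w => f (x₀ + w)), fderiv_comp_add_left]
  simp [partialD]

theorem setIntegral_ball_homothety (f : Pt n → ℝ) (x₀ : Pt n) {h : ℝ} (hh : 0 < h) (s : ℝ) :
    ∫ y in Metric.ball (0 : Pt n) s, f (x₀ + h • y) =
      (h ^ n)⁻¹ * ∫ x in Metric.ball x₀ (s * h), f x := by
  rw [← integral_indicator measurableSet_ball, ← integral_indicator measurableSet_ball]
  have h1 : (Metric.ball (0 : Pt n) s).indicator (fun y => f (x₀ + h • y)) =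
      fun y => (fun w => (Metric.ball x₀ (s * h)).indicator f (x₀ + w)) (h • y) := by
    funext y
    have : y ∈ Metric.ball (0 : Pt n) s ↔ x₀ + h • y ∈ Metric.ball x₀ (s * h) := by
      simp [dist_eq_norm, norm_smul, abs_of_pos hh, mul_comm s, hh]
    by_cases hy : y ∈ Metric.ball (0 : Pt n) s
    · simp only [Set.indicator_of_mem hy, Set.indicator_of_mem (this.1 hy)]
    · simp only [Set.indicator_of_notMem hy, Set.indicator_of_notMem (mt this.2 hy)]
  rw [h1, Measure.integral_comp_smul, integral_add_left_eq_self]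
  simp [abs_of_pos hh]

/-- Inverse estimates for polynomials of degree at most `k`, with the `L²` norm of a concentric
smaller ball on the right. -/
theorem exists_inverse_estimate (n k : ℕ) {s : ℝ} (hs : 0 < s) :
    ∃ K : ℝ, 0 < K ∧ ∀ p : MvPolynomial (Fin n) ℝ, p.totalDegree ≤ k →
      ∀ (x₀ : Pt n) (h : ℝ), 0 < h → ∀ x ∈ Metric.closedBall x₀ h,
        peval p x ^ 2 ≤ K * ((h ^ n)⁻¹ * ∫ x in Metric.ball x₀ (s * h), peval p x ^ 2) ∧
        (∀ i, (h * partialD i (peval p) x) ^ 2 ≤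
          K * ((h ^ n)⁻¹ * ∫ x in Metric.ball x₀ (s * h), peval p x ^ 2)) ∧
        (∀ i, (h ^ 2 * partialD i (partialD i (peval p)) x) ^ 2 ≤
          K * ((h ^ n)⁻¹ * ∫ x in Metric.ball x₀ (s * h), peval p x ^ 2)) := by
  obtain ⟨K₀, hK₀, H₀⟩ := exists_sq_le_integral_unit (n := n) k hs LinearMap.id
  have e1 := fun i : Fin n => exists_sq_le_integral_unit (n := n) k hs
    (MvPolynomial.pderiv i).toLinearMap
  have e2 := fun i : Fin n => exists_sq_le_integral_unit (n := n) k hs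
    ((MvPolynomial.pderiv i).toLinearMap ∘ₗ (MvPolynomial.pderiv i).toLinearMap)
  choose K₁ hK₁ H₁ using e1
  choose K₂ hK₂ H₂ using e2
  have hle : ∀ i, K₀ ≤ K₀ + ∑ i, (K₁ i + K₂ i) ∧ K₁ i ≤ K₀ + ∑ i, (K₁ i + K₂ i) ∧
      K₂ i ≤ K₀ + ∑ i, (K₁ i + K₂ i) := fun i => by
    have := Finset.single_le_sum (f := fun i => K₁ i + K₂ i)
      (fun i _ => (add_pos (hK₁ i) (hK₂ i)).le) (Finset.mem_univ i)
    have a1 := hK₁ i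
    have a2 := hK₂ i
    refine ⟨by linarith, by linarith, by linarith⟩
  have hK : 0 ≤ ∑ i, (K₁ i + K₂ i) :=
    Finset.sum_nonneg fun i _ => (add_pos (hK₁ i) (hK₂ i)).le
  refine ⟨K₀ + ∑ i, (K₁ i + K₂ i), by positivity, fun p hp x₀ h hh x hx => ?_⟩
  -- Pull back to the unit ball by `y ↦ x₀ + h y`: each derivative of `q` carries a factor `h`, and
  -- the volume element gives `h⁻ⁿ`.
  obtain ⟨q, hq, hqp⟩ := exists_peval_homothety p x₀ h
  have hI : ∫ y in Metric.ball (0 : Pt n) s, peval q y ^ 2 =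
      (h ^ n)⁻¹ * ∫ x in Metric.ball x₀ (s * h), peval p x ^ 2 := by
    rw [funext hqp]
    exact setIntegral_ball_homothety (fun x => peval p x ^ 2) x₀ hh s
  have hI0 : 0 ≤ ∫ y in Metric.ball (0 : Pt n) s, peval q y ^ 2 :=
    integral_nonneg fun _ => sq_nonneg _
  rw [← hI]
  set y : Pt n := h⁻¹ • (x - x₀) with hy
  have hxy : x₀ + h • y = x := by
    rw [hy, smul_smul, mul_inv_cancel₀ hh.ne', one_smul]; abel
  have hy1 : y ∈ Metric.closedBall (0 : Pt n) 1 := by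
    rw [mem_closedBall_zero_iff, hy, norm_smul, norm_inv, Real.norm_of_nonneg hh.le,
      inv_mul_le_iff₀ hh, mul_one, ← dist_eq_norm]
    exact hx
  have hfun : peval q = fun z => peval p (x₀ + h • z) := funext hqp
  have hD : ∀ i, partialD i (peval q) = fun z => h * partialD i (peval p) (x₀ + h • z) := fun i => by
    rw [hfun]
    exact funext (partialD_comp_homothety i _ x₀ h)
  have hDD : ∀ i, partialD i (partialD i (peval q)) y =
      h ^ 2 * partialD i (partialD i (peval p)) x := fun i => by
    have hd : DifferentiableAt ℝ (fun z => partialD i (peval p) (x₀ + h • z)) y := by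
      rw [partialD_peval]
      exact (differentiable_peval _).comp (by fun_prop) y
    rw [hD i, partialD, fderiv_const_mul hd, smul_apply, smul_eq_mul]
    have := partialD_comp_homothety i (partialD i (peval p)) x₀ h y
    rw [partialD] at this
    rw [this, hxy]; ring
  have hqk := hq.trans hp
  refine ⟨?_, fun i => ?_, fun i => ?_⟩
  · rw [← hxy, ← hqp]
    exact (H₀ q hqk y hy1).trans (by nlinarith)
  · have h1 := H₁ i q hqk y hy1
    simp only [Derivation.coeFn_coe, ← partialD_peval, hD, hxy] at h1
    exact h1.trans (mul_le_mul_of_nonneg_right (hle i).2.1 hI0)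
  · have h1 := H₂ i q hqk y hy1
    simp only [LinearMap.comp_apply, Derivation.coeFn_coe, ← partialD_peval, hDD] at h1
    exact h1.trans (mul_le_mul_of_nonneg_right (hle i).2.2 hI0)

/-! ### Geometry of a simplex -/

theorem cell_eq (T : Simp n) : cell T = {x | ∀ i, 0 ≤ T.coord i x} :=
  T.convexHull_eq_nonneg_coord

theorem interior_cell_eq (T : Simp n) : interior (cell T) = {x | ∀ i, 0 < T.coord i x} :=
  T.interior_convexHull

theorem coord_nonneg (T : Simp n) {x : Pt n} (hx : x ∈ cell T) (i : Fin (n + 1)) :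
    0 ≤ T.coord i x := by
  rw [cell_eq] at hx
  exact hx i

theorem coord_le_one (T : Simp n) {x : Pt n} (hx : x ∈ cell T) (i : Fin (n + 1)) :
    T.coord i x ≤ 1 := by
  rw [← T.sum_coord_apply_eq_one x]
  exact Finset.single_le_sum (fun j _ => coord_nonneg T hx j) (Finset.mem_univ i)

theorem vertex_mem_cell (T : Simp n) (i : Fin (n + 1)) : T i ∈ cell T :=
  subset_convexHull ℝ _ (Set.mem_range_self i)

theorem dist_le_cellDiam (T : Simp n) {x y : Pt n} (hx : x ∈ cell T) (hy : y ∈ cell T) :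
    dist x y ≤ cellDiam T :=
  Metric.dist_le_diam_of_mem (isCompact_cell T).isBounded hx hy

theorem cellDiam_pos (hn : n ≠ 0) (T : Simp n) : 0 < cellDiam T := by
  have h01 : (0 : Fin (n + 1)) ≠ Fin.last n := by
    intro h
    exact hn (by simpa using (congrArg Fin.val h).symm)
  have : T 0 ≠ T (Fin.last n) := fun h => h01 (T.ind.injective h)
  exact (dist_pos.2 this).trans_le
    (dist_le_cellDiam T (vertex_mem_cell T _) (vertex_mem_cell T _))

theorem hasFDerivAt_coord (T : Simp n) (i : Fin (n + 1)) (x : Pt n) :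
    HasFDerivAt (T.coord i) (LinearMap.toContinuousLinearMap (T.coord i).linear) x := by
  have h1 : (T.coord i : Pt n → ℝ) =
      fun y => LinearMap.toContinuousLinearMap (T.coord i).linear y + T.coord i 0 := by
    funext y
    simpa using congrFun (T.coord i).decomp y
  have h2 := (LinearMap.toContinuousLinearMap (T.coord i).linear).hasFDerivAt (x := x)
  have h3 := h2.add_const (T.coord i 0)
  rw [← h1] at h3
  exact h3

theorem contDiff_coord (T : Simp n) (i : Fin (n + 1)) : ContDiff ℝ ∞ (T.coord i) := by
  have h1 : (T.coord i : Pt n → ℝ) =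
      fun y => LinearMap.toContinuousLinearMap (T.coord i).linear y + T.coord i 0 := by
    funext y
    simpa using congrFun (T.coord i).decomp y
  rw [h1]
  exact (ContinuousLinearMap.contDiff _).add contDiff_const

theorem continuous_coord (T : Simp n) (i : Fin (n + 1)) : Continuous (T.coord i) :=
  (contDiff_coord T i).continuous

theorem partialD_coord (T : Simp n) (i : Fin (n + 1)) (j : Fin n) (x : Pt n) :
    partialD j (T.coord i) x = (T.coord i).linear (EuclideanSpace.single j 1) := by
  rw [partialD, (hasFDerivAt_coord T i x).fderiv]
  rfl

theorem coord_add (T : Simp n) (i : Fin (n + 1)) (x v : Pt n) :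
    T.coord i (x + v) = (T.coord i).linear v + T.coord i x := by
  have := (T.coord i).map_vadd x v
  rwa [vadd_eq_add, vadd_eq_add, add_comm v x] at this

/-- A barycentric coordinate takes values in `[0, 1]` on `T`, so a displacement of length at most
`ρ` from the centre changes it by at most one. -/
theorem abs_linear_coord_le (T : Simp n) {x₀ : Pt n} {ρ : ℝ} (hρ : 0 < ρ)
    (hball : Metric.closedBall x₀ ρ ⊆ cell T) (i : Fin (n + 1)) {v : Pt n} (hv : ‖v‖ ≤ 1) :
    |(T.coord i).linear v| ≤ ρ⁻¹ := by
  have hx₀ : x₀ ∈ cell T := hball (Metric.mem_closedBall_self hρ.le)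
  have hxv : x₀ + ρ • v ∈ cell T := hball <| by
    rw [Metric.mem_closedBall, dist_eq_norm, add_sub_cancel_left, norm_smul,
      Real.norm_of_nonneg hρ.le]
    exact mul_le_of_le_one_right hρ.le hv
  have h1 := coord_add T i x₀ (ρ • v)
  rw [map_smul, smul_eq_mul] at h1
  have a1 := coord_nonneg T hx₀ i
  have a2 := coord_le_one T hx₀ i
  have a3 := coord_nonneg T hxv i
  have a4 := coord_le_one T hxv i
  have h2 : |ρ * (T.coord i).linear v| ≤ 1 := abs_le.2 ⟨by linarith, by linarith⟩
  rw [abs_mul, abs_of_pos hρ] at h2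
  rwa [← mul_one ρ⁻¹, le_inv_mul_iff₀ hρ]

/-- Along an edge vector `d` from another vertex to `T i` the coordinate grows at rate one. Moving
from `x` by `-(2σ)⁻¹ d` stays in the inscribed ball, where the coordinate is still nonnegative;
hence it was at least `(2σ)⁻¹` at `x`. -/
theorem le_coord_of_mem_ball (hn : n ≠ 0) (T : Simp n) {x₀ : Pt n} {σ : ℝ} (hσ : 0 < σ)
    (hball : Metric.closedBall x₀ (cellDiam T / σ) ⊆ cell T) (i : Fin (n + 1)) {x : Pt n}
    (hx : x ∈ Metric.ball x₀ ((2 * σ)⁻¹ * cellDiam T)) : (2 * σ)⁻¹ ≤ T.coord i x := by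
  have hh := cellDiam_pos hn T
  have : Nontrivial (Fin (n + 1)) := Fin.nontrivial_iff_two_le.2 (by omega)
  obtain ⟨j, hj⟩ := exists_ne i
  set d := T i - T j with hd
  have hdn : ‖d‖ ≤ cellDiam T := by
    rw [hd, ← dist_eq_norm]
    exact dist_le_cellDiam T (vertex_mem_cell T _) (vertex_mem_cell T _)
  have hld : (T.coord i).linear d = 1 := by
    have h1 := coord_add T i (T j) d
    rw [hd, add_sub_cancel, T.coord_apply_eq, T.coord_apply_ne hj.symm, ← hd, add_zero] at h1
    exact h1.symm
  have hy : x + (-(2 * σ)⁻¹) • d ∈ cell T := hball <| by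
    rw [Metric.mem_closedBall]
    have h1 : dist (x + (-(2 * σ)⁻¹) • d) x ≤ (2 * σ)⁻¹ * cellDiam T := by
      rw [dist_eq_norm, add_sub_cancel_left, norm_smul, norm_neg, Real.norm_of_nonneg (by positivity)]
      gcongr
    have h2 := dist_triangle (x + (-(2 * σ)⁻¹) • d) x x₀
    have h3 := (Metric.mem_ball.1 hx).le
    have h4 : cellDiam T / σ = (2 * σ)⁻¹ * cellDiam T + (2 * σ)⁻¹ * cellDiam T := by
      field_simp; norm_num
    linarith
  have h1 := coord_nonneg T hy i
  rw [coord_add, map_smul, hld] at h1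
  simp only [smul_eq_mul, mul_one] at h1
  linarith

/-! ### The bubble function and inverse estimates on a simplex -/

theorem continuous_bubble (T : Simp n) : Continuous (bubble T) :=
  continuous_finsetProd _ fun i _ => (continuous_coord T i).pow 2

theorem bubble_nonneg (T : Simp n) (x : Pt n) : 0 ≤ bubble T x :=
  Finset.prod_nonneg fun _ _ => sq_nonneg _

theorem bubble_le_one (T : Simp n) {x : Pt n} (hx : x ∈ cell T) : bubble T x ≤ 1 :=
  Finset.prod_le_one (fun _ _ => sq_nonneg _) fun i _ =>
    pow_le_one₀ (coord_nonneg T hx i) (coord_le_one T hx i)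

instance isFiniteMeasure_cellMeasure (T : Simp n) : IsFiniteMeasure (cellMeasure T) :=
  ⟨by simpa [cellMeasure] using (isCompact_cell T).measure_lt_top⟩

theorem integrable_cell_of_continuous (T : Simp n) {w : Pt n → ℝ} (hw : Continuous w) :
    Integrable w (cellMeasure T) :=
  hw.continuousOn.integrableOn_compact (isCompact_cell T)

theorem integrableOn_ball_of_continuous {w : Pt n → ℝ} (hw : Continuous w) (x : Pt n) (ρ : ℝ) :
    IntegrableOn w (Metric.ball x ρ) :=
  (hw.continuousOn.integrableOn_compact (isCompact_closedBall x ρ)).mono_set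
    Metric.ball_subset_closedBall

theorem measureReal_cell_le (T : Simp n) {x₀ : Pt n} (hx₀ : x₀ ∈ cell T) :
    (cellMeasure T).real Set.univ ≤
      cellDiam T ^ n * volume.real (Metric.ball (0 : Pt n) 1) := by
  have hsub : cell T ⊆ Metric.closedBall x₀ (cellDiam T) := fun x hx =>
    dist_le_cellDiam T hx hx₀
  have h1 : (cellMeasure T).real Set.univ = volume.real (cell T) := by
    simp [cellMeasure, Measure.real]
  rw [h1]
  refine (measureReal_mono hsub measure_closedBall_lt_top.ne).trans_eq ?_
  have hd : 0 ≤ cellDiam T := Metric.diam_nonneg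
  rw [Measure.real, Measure.addHaar_closedBall _ _ hd, ENNReal.toReal_mul,
    ENNReal.toReal_ofReal (pow_nonneg hd _), finrank_euclideanSpace_fin]
  rfl

/-- Inverse estimates on shape-regular simplices: the derivatives up to order two of a polynomial
`p` are bounded by `M`, which is controlled by the `L¹` norm and by testing with `b_T p`. -/
theorem exists_cell_inverse_estimate (hn : n ≠ 0) (k : ℕ) {σ : ℝ} (hσ : 0 < σ) :
    ∃ A : ℝ, 0 < A ∧ ∀ (T : Simp n) (x₀ : Pt n),
      Metric.closedBall x₀ (cellDiam T / σ) ⊆ cell T →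
      ∀ p : MvPolynomial (Fin n) ℝ, p.totalDegree ≤ k → ∃ M : ℝ, 0 ≤ M ∧
        (∀ x ∈ cell T, |peval p x| ≤ M ∧ (∀ i, |cellDiam T * partialD i (peval p) x| ≤ M) ∧
          ∀ i, |cellDiam T ^ 2 * partialD i (partialD i (peval p)) x| ≤ M) ∧
        cellDiam T ^ n * M ≤ A * ∫ x, |peval p x| ∂(cellMeasure T) ∧
        M * ∫ x, |peval p x| ∂(cellMeasure T) ≤
          A * ∫ x, bubble T x * peval p x * peval p x ∂(cellMeasure T) := by
  have hs : 0 < (2 * σ)⁻¹ := by positivity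
  obtain ⟨K, hK, H⟩ := exists_inverse_estimate n k hs
  set κ := volume.real (Metric.ball (0 : Pt n) 1) with hκ
  have hκ0 : 0 ≤ κ := measureReal_nonneg
  -- Lower bound for `b_T` on the inner ball: all `n + 1` coordinates are at least `(2σ)⁻¹` there.
  set c := (((2 * σ)⁻¹) ^ 2) ^ (n + 1) with hc
  have hc0 : 0 < c := by positivity
  refine ⟨K + κ * K / c, by positivity, fun T x₀ hball p hp => ?_⟩
  have hh := cellDiam_pos hn T
  set h := cellDiam T with hh'
  have hx₀ : x₀ ∈ cell T := hball (Metric.mem_closedBall_self (by positivity))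
  set B := Metric.ball x₀ ((2 * σ)⁻¹ * h) with hB
  set I := ∫ x in B, peval p x ^ 2 with hI
  have hI0 : 0 ≤ I := integral_nonneg fun _ => sq_nonneg _
  have hBT : B ⊆ cell T := by
    refine (Metric.ball_subset_closedBall.trans (Metric.closedBall_subset_closedBall ?_)).trans
      hball
    rw [inv_mul_eq_div]
    gcongr
    linarith
  -- `M` is a scaled `L²` norm over the inner ball `B`. It bounds `p` and its scaled derivatives on
  -- all of `T`, because `T` lies in the closed ball of radius `h` about `x₀`.
  set M := Real.sqrt (K * ((h ^ n)⁻¹ * I)) with hM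
  have hM0 : 0 ≤ M := Real.sqrt_nonneg _
  have hM2 : M ^ 2 = K * ((h ^ n)⁻¹ * I) := Real.sq_sqrt (by positivity)
  have hbd : ∀ x ∈ cell T, |peval p x| ≤ M ∧ (∀ i, |h * partialD i (peval p) x| ≤ M) ∧
      ∀ i, |h ^ 2 * partialD i (partialD i (peval p)) x| ≤ M := fun x hx => by
    obtain ⟨h0, h1, h2⟩ := H p hp x₀ h hh x (dist_le_cellDiam T hx hx₀)
    exact ⟨Real.abs_le_sqrt h0, fun i => Real.abs_le_sqrt (h1 i), fun i => Real.abs_le_sqrt (h2 i)⟩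
  set J := ∫ x, |peval p x| ∂(cellMeasure T) with hJ
  have hJ0 : 0 ≤ J := integral_nonneg fun _ => abs_nonneg _
  have hIM : h ^ n * M ^ 2 = K * I := by
    rw [hM2]; field_simp
  have hIJ : I ≤ M * J := by
    have h1 : I ≤ ∫ x in B, M * |peval p x| := by
      refine setIntegral_mono_on ?_ ?_ measurableSet_ball fun x hx => ?_
      · exact integrableOn_ball_of_continuous ((continuous_peval p).pow 2) _ _
      · exact integrableOn_ball_of_continuous (continuous_const.mul (continuous_peval p).abs) _ _
      · rw [← sq_abs, sq]
        exact mul_le_mul_of_nonneg_right (hbd x (hBT hx)).1 (abs_nonneg _)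
    refine h1.trans ?_
    rw [integral_const_mul]
    refine mul_le_mul_of_nonneg_left ?_ hM0
    exact setIntegral_mono_set (integrable_cell_of_continuous T (continuous_peval p).abs)
      (ae_of_all _ fun _ => abs_nonneg _) hBT.eventuallyLE
  have hbub : c * I ≤ ∫ x, bubble T x * peval p x * peval p x ∂(cellMeasure T) := by
    rw [hI, ← integral_const_mul]
    have hcont : Continuous fun x => bubble T x * peval p x * peval p x :=
      ((continuous_bubble T).mul (continuous_peval p)).mul (continuous_peval p)
    refine le_trans (setIntegral_mono_on ?_ ?_ measurableSet_ball fun x hx => ?_)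
      (setIntegral_mono_set (integrable_cell_of_continuous T hcont)
        (ae_of_all _ fun x => ?_) hBT.eventuallyLE)
    · exact integrableOn_ball_of_continuous (continuous_const.mul ((continuous_peval p).pow 2)) _ _
    · exact integrableOn_ball_of_continuous hcont _ _
    · rw [mul_assoc, ← sq]
      refine mul_le_mul_of_nonneg_right ?_ (sq_nonneg _)
      rw [hc, bubble]
      refine le_trans (by simp) (Finset.prod_le_prod (s := Finset.univ)
        (f := fun _ : Fin (n + 1) => ((2 * σ)⁻¹) ^ 2) (fun _ _ => sq_nonneg _) fun i _ => ?_)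
      exact pow_le_pow_left₀ hs.le (le_coord_of_mem_ball hn T hσ hball i hx) 2
    · have := bubble_nonneg T x
      simp only [Pi.zero_apply]
      rw [mul_assoc, ← sq]
      positivity
  refine ⟨M, hM0, hbd, ?_, ?_⟩
  -- `hⁿ M² = K I ≤ K M J`; divide by `M`.
  · rcases hM0.eq_or_lt with h0 | h0
    · rw [← h0, mul_zero]; positivity
    · have h1 : h ^ n * M ≤ K * J := by
        have : M * (h ^ n * M) ≤ M * (K * J) := by nlinarith
        exact le_of_mul_le_mul_left this h0
      have h2 : 0 ≤ κ * K / c * J := by positivity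
      linarith
  -- `M J ≤ κ hⁿ M² = κ K I`, and `I` is at most `c⁻¹` times the integral weighted by `b_T`.
  · have h1 : J ≤ M * (h ^ n * κ) := by
      have h2 : J ≤ ∫ _, M ∂(cellMeasure T) := by
        refine integral_mono_ae (integrable_cell_of_continuous T (continuous_peval p).abs)
          (integrable_const _) ?_
        exact (ae_restrict_iff' (isCompact_cell T).measurableSet).2
          (ae_of_all _ fun x hx => (hbd x hx).1)
      rw [integral_const, smul_eq_mul, mul_comm] at h2
      exact h2.trans (mul_le_mul_of_nonneg_left (measureReal_cell_le T hx₀) hM0)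
    set Q := ∫ x, bubble T x * peval p x * peval p x ∂(cellMeasure T) with hQ
    have h2 : M * J ≤ κ * (K * I) := by
      rw [← hIM]; nlinarith
    have h3 : κ * K * I ≤ κ * K / c * Q := by
      rw [div_mul_eq_mul_div, le_div_iff₀ hc0]
      have : 0 ≤ κ * K := by positivity
      nlinarith
    have hQ0 : 0 ≤ Q := le_trans (by positivity) hbub
    have : 0 ≤ K * Q := by positivity
    nlinarith

/-! ### Smooth cutoffs of the bubble function -/

/-- A smooth function on the line that vanishes on `(-∞, 1]` and equals `s²` on `[2, ∞)`. -/
def smoothSq (s : ℝ) : ℝ := s ^ 2 * Real.smoothTransition (s - 1)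

theorem contDiff_smoothSq : ContDiff ℝ ∞ smoothSq :=
  (contDiff_id.pow 2).mul (Real.smoothTransition.contDiff.comp (contDiff_id.sub contDiff_const))

theorem smoothSq_of_le_one {s : ℝ} (hs : s ≤ 1) : smoothSq s = 0 := by
  rw [smoothSq, Real.smoothTransition.zero_of_nonpos (by linarith), mul_zero]

theorem smoothSq_of_two_le {s : ℝ} (hs : 2 ≤ s) : smoothSq s = s ^ 2 := by
  rw [smoothSq, Real.smoothTransition.one_of_one_le (by linarith), mul_one]

theorem smoothSq_nonneg (s : ℝ) : 0 ≤ smoothSq s :=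
  mul_nonneg (sq_nonneg _) (Real.smoothTransition.nonneg _)

theorem smoothSq_le_sq (s : ℝ) : smoothSq s ≤ s ^ 2 :=
  mul_le_of_le_one_right (sq_nonneg _) (Real.smoothTransition.le_one _)

theorem contDiff_deriv_smoothSq : ContDiff ℝ ∞ (deriv smoothSq) :=
  ((contDiff_infty_iff_deriv (f := smoothSq)).1 contDiff_smoothSq).2

theorem contDiff_deriv_deriv_smoothSq : ContDiff ℝ ∞ (deriv (deriv smoothSq)) :=
  ((contDiff_infty_iff_deriv (f := deriv smoothSq)).1 contDiff_deriv_smoothSq).2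

theorem deriv_smoothSq_of_lt_one {s : ℝ} (hs : s < 1) : deriv smoothSq s = 0 := by
  have : smoothSq =ᶠ[𝓝 s] fun _ => 0 := by
    filter_upwards [Iio_mem_nhds hs] with t ht using smoothSq_of_le_one (le_of_lt ht)
  rw [this.deriv_eq, deriv_const]

theorem deriv_smoothSq_of_two_lt {s : ℝ} (hs : 2 < s) : deriv smoothSq s = 2 * s := by
  have : smoothSq =ᶠ[𝓝 s] fun s => s ^ 2 := by
    filter_upwards [Ioi_mem_nhds hs] with t ht using smoothSq_of_two_le (le_of_lt ht)
  rw [this.deriv_eq]; simp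

/-- The second derivative is `0` to the left of `1` and `2` to the right of `2`; in between it is
bounded by compactness. -/
theorem exists_bound_deriv_deriv_smoothSq :
    ∃ A : ℝ, 0 < A ∧ ∀ s, |deriv (deriv smoothSq) s| ≤ A := by
  obtain ⟨A, hA⟩ := (isCompact_Icc (a := (0 : ℝ)) (b := 3)).exists_bound_of_continuousOn
    contDiff_deriv_deriv_smoothSq.continuous.continuousOn
  refine ⟨max A 2, by positivity, fun s => ?_⟩
  rcases lt_or_ge s 1 with h1 | h1
  · have : deriv smoothSq =ᶠ[𝓝 s] fun _ => 0 := by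
      filter_upwards [Iio_mem_nhds h1] with t ht using deriv_smoothSq_of_lt_one ht
    rw [this.deriv_eq, deriv_const]; simp
  rcases lt_or_ge 2 s with h2 | h2
  · have : deriv smoothSq =ᶠ[𝓝 s] fun s => 2 * s := by
      filter_upwards [Ioi_mem_nhds h2] with t ht using deriv_smoothSq_of_two_lt ht
    rw [this.deriv_eq, deriv_const_mul_id']; simp
  · exact (hA s ⟨by linarith, by linarith⟩).trans (le_max_left _ _)

/-- Mean value inequality from `0`, where the first derivative vanishes. -/
theorem abs_deriv_smoothSq_le {A : ℝ} (hA : ∀ s, |deriv (deriv smoothSq) s| ≤ A) (s : ℝ) :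
    |deriv smoothSq s| ≤ A * |s| := by
  have h := Convex.norm_image_sub_le_of_norm_deriv_le (f := deriv smoothSq) (s := Set.univ) (C := A)
    (fun x _ => contDiff_deriv_smoothSq.differentiable (by simp) x) (fun x _ => hA x) convex_univ
    (Set.mem_univ 0) (Set.mem_univ s)
  simpa [deriv_smoothSq_of_lt_one] using h

/-- The rescaled function `smoothSq`, which tends to `t²` on `[0, ∞)` as `c → ∞`. -/
def cutoffSq (c t : ℝ) : ℝ := (c ^ 2)⁻¹ * smoothSq (c * t)

theorem contDiff_cutoffSq (c : ℝ) : ContDiff ℝ ∞ (cutoffSq c) :=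
  contDiff_const.mul (contDiff_smoothSq.comp (contDiff_const.mul contDiff_id))

theorem cutoffSq_of_mul_le_one {c t : ℝ} (h : c * t ≤ 1) : cutoffSq c t = 0 := by
  rw [cutoffSq, smoothSq_of_le_one h, mul_zero]

theorem cutoffSq_nonneg (c t : ℝ) : 0 ≤ cutoffSq c t :=
  mul_nonneg (by positivity) (smoothSq_nonneg _)

theorem cutoffSq_le_sq {c : ℝ} (hc : 0 < c) (t : ℝ) : cutoffSq c t ≤ t ^ 2 := by
  rw [cutoffSq, inv_mul_le_iff₀ (by positivity), ← mul_pow]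
  exact smoothSq_le_sq _

/-- For `t > 0` the sequence equals `t²` once `(k + 1) t ≥ 2`. -/
theorem tendsto_cutoffSq {t : ℝ} (ht : 0 ≤ t) :
    Tendsto (fun k : ℕ => cutoffSq (k + 1) t) atTop (𝓝 (t ^ 2)) := by
  rcases ht.eq_or_lt with rfl | ht
  · simp [cutoffSq, smoothSq]
  refine tendsto_const_nhds.congr' ?_
  obtain ⟨N, hN⟩ := exists_nat_ge (2 / t)
  filter_upwards [eventually_ge_atTop N] with k hk
  have h1 : 2 ≤ ((k : ℝ) + 1) * t := by
    rw [div_le_iff₀ ht] at hN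
    have : (N : ℝ) ≤ k := by exact_mod_cast hk
    nlinarith
  rw [cutoffSq, smoothSq_of_two_le h1]
  have : ((k : ℝ) + 1) ≠ 0 := by positivity
  field_simp

theorem deriv_cutoffSq {c : ℝ} (hc : 0 < c) :
    deriv (cutoffSq c) = fun t => c⁻¹ * deriv smoothSq (c * t) := by
  funext t
  have h := deriv_comp_mul_left c smoothSq t
  have : cutoffSq c = fun t => (c ^ 2)⁻¹ * smoothSq (c * t) := rfl
  rw [this, deriv_const_mul_field, h, smul_eq_mul]
  field_simp

/-- The prefactor `c⁻²` cancels the two factors `c` of the chain rule, so the bound on the second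
derivative does not depend on `c`. This is what the squares in `b_T` are for. -/
theorem deriv_deriv_cutoffSq {c : ℝ} (hc : 0 < c) :
    deriv (deriv (cutoffSq c)) = fun t => deriv (deriv smoothSq) (c * t) := by
  funext t
  have h := deriv_comp_mul_left c (deriv smoothSq) t
  rw [deriv_cutoffSq hc, deriv_const_mul_field, h, smul_eq_mul]
  field_simp

/-! ### Leibniz rules and scaled derivative bounds -/

theorem contDiff_partialD {f : Pt n → ℝ} (hf : ContDiff ℝ ∞ f) (i : Fin n) :
    ContDiff ℝ ∞ (partialD i f) :=
  (hf.fderiv_right (m := ∞) (by simp)).clm_apply contDiff_const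

theorem partialD_mul {f g : Pt n → ℝ} (hf : Differentiable ℝ f) (hg : Differentiable ℝ g)
    (i : Fin n) :
    partialD i (fun x => f x * g x) = fun x => f x * partialD i g x + partialD i f x * g x := by
  funext x
  have h := ((hf x).hasFDerivAt.mul (hg x).hasFDerivAt).fderiv
  rw [show (f * g) = fun x => f x * g x from rfl] at h
  rw [partialD, h]
  simp [partialD, mul_comm]

theorem partialD_add {f g : Pt n → ℝ} (hf : Differentiable ℝ f) (hg : Differentiable ℝ g)
    (i : Fin n) :
    partialD i (fun x => f x + g x) = fun x => partialD i f x + partialD i g x := by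
  funext x
  have h := ((hf x).hasFDerivAt.add (hg x).hasFDerivAt).fderiv
  rw [show (f + g) = fun x => f x + g x from rfl] at h
  rw [partialD, h]
  rfl

theorem partialD_partialD_mul {f g : Pt n → ℝ} (hf : ContDiff ℝ ∞ f) (hg : ContDiff ℝ ∞ g)
    (i : Fin n) (x : Pt n) :
    partialD i (partialD i (fun x => f x * g x)) x = f x * partialD i (partialD i g) x +
      2 * (partialD i f x * partialD i g x) + partialD i (partialD i f) x * g x := by
  have df := hf.differentiable (by simp)
  have dg := hg.differentiable (by simp)
  have df' := (contDiff_partialD hf i).differentiable (by simp)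
  have dg' := (contDiff_partialD hg i).differentiable (by simp)
  have h1 : Differentiable ℝ fun x => f x * partialD i g x := df.mul dg'
  have h2 : Differentiable ℝ fun x => partialD i f x * g x := df'.mul dg
  rw [partialD_mul df dg, partialD_add h1 h2, partialD_mul df dg', partialD_mul df' dg]
  ring

/-- `f` and its pure partial derivatives up to order two, scaled by powers of `h`, are bounded by
`A` on `S`. -/
def ScaledBound (h A : ℝ) (S : Set (Pt n)) (f : Pt n → ℝ) : Prop :=
  ∀ x ∈ S, |f x| ≤ A ∧ ∀ i, |h * partialD i f x| ≤ A ∧ |h ^ 2 * partialD i (partialD i f) x| ≤ A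

/-- The factor `4` counts the terms `1 + 2 + 1` of the second-order Leibniz rule, each at most `A
B`. -/
theorem ScaledBound.mul {h A B : ℝ} {S : Set (Pt n)} {f g : Pt n → ℝ} (hf : ContDiff ℝ ∞ f)
    (hg : ContDiff ℝ ∞ g) (hA : ScaledBound h A S f) (hB : ScaledBound h B S g) :
    ScaledBound h (4 * A * B) S (fun x => f x * g x) := by
  intro x hx
  obtain ⟨f0, f12⟩ := hA x hx
  obtain ⟨g0, g12⟩ := hB x hx
  have hA0 : 0 ≤ A := (abs_nonneg _).trans f0
  have hB0 : 0 ≤ B := (abs_nonneg _).trans g0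
  have hAB : 0 ≤ A * B := mul_nonneg hA0 hB0
  have key : ∀ {s t : ℝ}, |s| ≤ A → |t| ≤ B → |s * t| ≤ A * B := fun hs ht => by
    rw [abs_mul]; exact mul_le_mul hs ht (abs_nonneg _) hA0
  refine ⟨(key f0 g0).trans (by linarith), fun i => ⟨?_, ?_⟩⟩
  · rw [partialD_mul (hf.differentiable (by simp)) (hg.differentiable (by simp))]
    have h1 := key f0 (g12 i).1
    have h2 := key (f12 i).1 g0
    have e : h * (f x * partialD i g x + partialD i f x * g x) =
      f x * (h * partialD i g x) + h * partialD i f x * g x := by ring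
    rw [e]
    refine (abs_add_le _ _).trans (by linarith)
  · rw [partialD_partialD_mul hf hg]
    have h1 := key f0 (g12 i).2
    have h2 := key (f12 i).1 (g12 i).1
    have h3 := key (f12 i).2 g0
    have e : h ^ 2 * (f x * partialD i (partialD i g) x +
        2 * (partialD i f x * partialD i g x) + partialD i (partialD i f) x * g x) =
      f x * (h ^ 2 * partialD i (partialD i g) x) + (h * partialD i f x) * (h * partialD i g x) +
      (h * partialD i f x) * (h * partialD i g x) + h ^ 2 * partialD i (partialD i f) x * g x := by
      ring
    rw [e]
    have a1 := abs_add_le (f x * (h ^ 2 * partialD i (partialD i g) x) +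
      (h * partialD i f x) * (h * partialD i g x) + (h * partialD i f x) * (h * partialD i g x))
      (h ^ 2 * partialD i (partialD i f) x * g x)
    have a2 := abs_add_three (f x * (h ^ 2 * partialD i (partialD i g) x))
      ((h * partialD i f x) * (h * partialD i g x)) ((h * partialD i f x) * (h * partialD i g x))
    linarith

theorem ScaledBound.prod {ι : Type*} {h A : ℝ} {S : Set (Pt n)} {f : ι → Pt n → ℝ}
    (hf : ∀ i, ContDiff ℝ ∞ (f i)) (hA : ∀ i, ScaledBound h A S (f i)) (s : Finset ι) :
    ScaledBound h ((4 * A) ^ s.card) S (fun x => ∏ i ∈ s, f i x) := by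
  classical
  induction s using Finset.induction_on with
  | empty =>
    have h0 : ∀ i : Fin n, partialD i (fun _ : Pt n => (1 : ℝ)) = fun _ => 0 := fun i => by
      funext x; simp [partialD]
    have h1 : ∀ i : Fin n, partialD i (fun _ : Pt n => (0 : ℝ)) = fun _ => 0 := fun i => by
      funext x; simp [partialD]
    intro x _
    simp [h0, h1]
  | insert i s hi ih =>
    simp only [Finset.prod_insert hi, Finset.card_insert_of_notMem hi]
    have := (hA i).mul (hf i) (contDiff_prod fun j _ => hf j) ih
    rwa [pow_succ, mul_comm]

/-- The smooth functions, compactly supported in the interior of `T`, which approximate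
`b_T p`. -/
def testFn (c : ℝ) (T : Simp n) (p : MvPolynomial (Fin n) ℝ) (x : Pt n) : ℝ :=
  peval p x * ∏ i, cutoffSq c (T.coord i x)

theorem contDiff_cutoff_coord (c : ℝ) (T : Simp n) (i : Fin (n + 1)) :
    ContDiff ℝ ∞ (fun x => cutoffSq c (T.coord i x)) :=
  (contDiff_cutoffSq c).comp (contDiff_coord T i)

theorem contDiff_testFn (c : ℝ) (T : Simp n) (p : MvPolynomial (Fin n) ℝ) :
    ContDiff ℝ ∞ (testFn c T p) :=
  (contDiff_peval p).mul (contDiff_prod fun i _ => contDiff_cutoff_coord c T i)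

/-- A nonzero value forces every `λ_i ≥ 1/c`; this is a closed condition, and it keeps the support
away from `∂T`. -/
theorem tsupport_testFn_subset {c : ℝ} (hc : 0 < c) (T : Simp n) (p : MvPolynomial (Fin n) ℝ) :
    tsupport (testFn c T p) ⊆ interior (cell T) := by
  have hcl : IsClosed {x : Pt n | ∀ i, c⁻¹ ≤ T.coord i x} := by
    simp only [Set.ofPred_forall]
    exact isClosed_iInter fun i => isClosed_le continuous_const (continuous_coord T i)
  refine (closure_minimal (fun x hx i => ?_) hcl).trans fun x hx => ?_
  · by_contra! h
    refine hx ?_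
    have : cutoffSq c (T.coord i x) = 0 := cutoffSq_of_mul_le_one <| by
      have := mul_lt_mul_of_pos_left h hc
      rw [mul_inv_cancel₀ hc.ne'] at this
      exact this.le
    rw [testFn, Finset.prod_eq_zero (Finset.mem_univ i) this, mul_zero]
  · rw [interior_cell_eq]
    exact fun i => (inv_pos.2 hc).trans_le (hx i)

theorem hasCompactSupport_testFn {c : ℝ} (hc : 0 < c) (T : Simp n)
    (p : MvPolynomial (Fin n) ℝ) : HasCompactSupport (testFn c T p) :=
  (isCompact_cell T).of_isClosed_subset (isClosed_tsupport _)
    ((tsupport_testFn_subset hc T p).trans interior_subset)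

theorem abs_testFn_le {c : ℝ} (hc : 0 < c) (T : Simp n) (p : MvPolynomial (Fin n) ℝ) {x : Pt n}
    (hx : x ∈ cell T) : |testFn c T p x| ≤ |peval p x| := by
  rw [testFn, abs_mul]
  refine mul_le_of_le_one_right (abs_nonneg _) ?_
  rw [abs_of_nonneg (Finset.prod_nonneg fun _ _ => cutoffSq_nonneg _ _)]
  exact Finset.prod_le_one (fun _ _ => cutoffSq_nonneg _ _) fun i _ =>
    (cutoffSq_le_sq hc _).trans (pow_le_one₀ (coord_nonneg T hx i) (coord_le_one T hx i))

theorem tendsto_testFn (T : Simp n) (p : MvPolynomial (Fin n) ℝ) {x : Pt n} (hx : x ∈ cell T) :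
    Tendsto (fun k : ℕ => testFn (k + 1) T p x) atTop (𝓝 (bubble T x * peval p x)) := by
  rw [mul_comm]
  exact tendsto_const_nhds.mul
    (tendsto_finsetProd _ fun i _ => tendsto_cutoffSq (coord_nonneg T hx i))

theorem partialD_comp (i : Fin n) {θ : ℝ → ℝ} (hθ : Differentiable ℝ θ) {f : Pt n → ℝ}
    (hf : Differentiable ℝ f) :
    partialD i (fun x => θ (f x)) = fun x => deriv θ (f x) * partialD i f x := by
  funext x
  have h := ((hθ (f x)).hasDerivAt.comp_hasFDerivAt x (hf x).hasFDerivAt).fderiv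
  rw [show (θ ∘ f) = fun x => θ (f x) from rfl] at h
  rw [partialD, h]
  rfl

/-- The inscribed ball gives `h |∂_j λ_i| ≤ σ`, and on `0 ≤ λ_i ≤ 1` both derivatives of the cutoff
are bounded by `A`, uniformly in `c`. Since `λ_i` is affine, second derivatives produce only the
square `(h ∂_j λ_i)² ≤ σ²`. -/
theorem exists_scaledBound_cutoff {σ : ℝ} (hσ : 0 < σ) (hn : n ≠ 0) :
    ∃ A : ℝ, 0 < A ∧ ∀ (c : ℝ), 0 < c → ∀ (T : Simp n) (x₀ : Pt n),
      Metric.closedBall x₀ (cellDiam T / σ) ⊆ cell T → ∀ i,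
      ScaledBound (cellDiam T) A (cell T) (fun x => cutoffSq c (T.coord i x)) := by
  obtain ⟨A, hA, hA2⟩ := exists_bound_deriv_deriv_smoothSq
  refine ⟨1 + A * σ + A * σ ^ 2, by positivity, fun c hc T x₀ hball i x hx => ?_⟩
  have hh := cellDiam_pos hn T
  have dc : Differentiable ℝ (T.coord i) := (contDiff_coord T i).differentiable (by simp)
  have d1 : Differentiable ℝ (cutoffSq c) := (contDiff_cutoffSq c).differentiable (by simp)
  have d2 : Differentiable ℝ (deriv (cutoffSq c)) :=
    ((contDiff_infty_iff_deriv (f := cutoffSq c)).1 (contDiff_cutoffSq c)).2.differentiable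
      (by simp)
  have c0 := coord_nonneg T hx i
  have c1 := coord_le_one T hx i
  have hl : ∀ j : Fin n, |cellDiam T * (T.coord i).linear (EuclideanSpace.single j 1)| ≤ σ :=
    fun j => by
      have := abs_linear_coord_le T (div_pos hh hσ) hball i
        (v := EuclideanSpace.single j 1) (by simp)
      rw [abs_mul, abs_of_pos hh]
      rw [inv_div, le_div_iff₀ hh] at this
      linarith
  have hp1 : 0 ≤ A * σ := by positivity
  have hp2 : 0 ≤ A * σ ^ 2 := by positivity
  refine ⟨?_, fun j => ⟨?_, ?_⟩⟩
  · rw [abs_of_nonneg (cutoffSq_nonneg _ _)]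
    have := (cutoffSq_le_sq hc _).trans (pow_le_one₀ (n := 2) c0 c1)
    linarith
  · rw [partialD_comp j d1 dc]
    simp only [partialD_coord]
    have e1 : |deriv (cutoffSq c) (T.coord i x)| ≤ A := by
      rw [deriv_cutoffSq hc, abs_mul, abs_of_pos (inv_pos.2 hc), inv_mul_le_iff₀ hc]
      refine (abs_deriv_smoothSq_le hA2 _).trans ?_
      rw [abs_mul, abs_of_pos hc, abs_of_nonneg c0]
      have : A * c * T.coord i x ≤ A * c * 1 := mul_le_mul_of_nonneg_left c1 (by positivity)
      linarith
    rw [mul_left_comm, abs_mul]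
    have := mul_le_mul e1 (hl j) (abs_nonneg _) hA.le
    linarith
  · have e2 : partialD j (partialD j (fun x => cutoffSq c (T.coord i x))) x =
        deriv (deriv (cutoffSq c)) (T.coord i x) *
          ((T.coord i).linear (EuclideanSpace.single j 1)) ^ 2 := by
      rw [partialD_comp j d1 dc]
      simp only [partialD_coord]
      have h3 : Differentiable ℝ fun x => deriv (cutoffSq c) (T.coord i x) := d2.comp dc
      have h4 := partialD_mul h3
        (differentiable_const ((T.coord i).linear (EuclideanSpace.single j 1))) j
      rw [h4, partialD_comp j d2 dc]
      simp only [partialD_coord]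
      simp only [partialD, fderiv_fun_const, Pi.zero_apply, zero_apply]
      ring
    rw [e2, deriv_deriv_cutoffSq hc]
    have e3 : cellDiam T ^ 2 * (deriv (deriv smoothSq) (c * T.coord i x) *
        ((T.coord i).linear (EuclideanSpace.single j 1)) ^ 2) =
      deriv (deriv smoothSq) (c * T.coord i x) *
        (cellDiam T * (T.coord i).linear (EuclideanSpace.single j 1)) ^ 2 := by ring
    rw [e3, abs_mul, abs_pow]
    have := mul_le_mul (hA2 (c * T.coord i x)) (pow_le_pow_left₀ (abs_nonneg _) (hl j) 2)
      (by positivity) hA.le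
    linarith

/-- The Laplacian of the test functions is bounded by `h⁻² ‖p‖_{L¹}`. -/
theorem exists_integral_abs_lap_testFn_le (hn : n ≠ 0) (k : ℕ) {σ : ℝ} (hσ : 0 < σ) :
    ∃ A : ℝ, 0 < A ∧ ∀ (T : Simp n) (x₀ : Pt n),
      Metric.closedBall x₀ (cellDiam T / σ) ⊆ cell T →
      ∀ p : MvPolynomial (Fin n) ℝ, p.totalDegree ≤ k → ∀ c : ℝ, 0 < c →
        cellDiam T ^ 2 * ∫ x, |lap (testFn c T p) x| ∂(cellMeasure T) ≤
          A * ∫ x, |peval p x| ∂(cellMeasure T) := by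
  obtain ⟨A₁, hA₁, H₁⟩ := exists_cell_inverse_estimate hn k hσ
  obtain ⟨A₂, hA₂, H₂⟩ := exists_scaledBound_cutoff hσ hn
  set κ := volume.real (Metric.ball (0 : Pt n) 1) with hκ
  have hκ0 : 0 ≤ κ := measureReal_nonneg
  -- Pointwise `h² |Δφ| ≤ n D M`, the volume of `T` is at most `κ hⁿ`, and `hⁿ M ≤ A₁ ‖p‖_{L¹}`. The
  -- summand `1` only ensures positivity.
  refine ⟨n * (4 * (4 * A₂) ^ (n + 1)) * κ * A₁ + 1, by positivity,
    fun T x₀ hball p hp c hc => ?_⟩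
  obtain ⟨M, hM0, hM, hMJ, -⟩ := H₁ T x₀ hball p hp
  have hh := cellDiam_pos hn T
  have hx₀ : x₀ ∈ cell T := hball (Metric.mem_closedBall_self (by positivity))
  have hb1 : ScaledBound (cellDiam T) M (cell T) (peval p) := fun x hx =>
    ⟨(hM x hx).1, fun i => ⟨(hM x hx).2.1 i, (hM x hx).2.2 i⟩⟩
  have hb2 := ScaledBound.prod (fun i => contDiff_cutoff_coord c T i) (H₂ c hc T x₀ hball)
    Finset.univ
  rw [Finset.card_univ, Fintype.card_fin] at hb2
  have hb3 : ScaledBound (cellDiam T) _ (cell T) (testFn c T p) :=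
    hb1.mul (contDiff_peval p) (contDiff_prod fun i _ => contDiff_cutoff_coord c T i) hb2
  set D := 4 * (4 * A₂) ^ (n + 1) with hD
  have hpt : ∀ x ∈ cell T, cellDiam T ^ 2 * |lap (testFn c T p) x| ≤ n * (D * M) := fun x hx => by
    rw [lap, ← abs_of_nonneg (sq_nonneg (cellDiam T)), ← abs_mul, Finset.mul_sum]
    refine (Finset.abs_sum_le_sum_abs _ _).trans ?_
    refine (Finset.sum_le_sum fun i _ => ((hb3 x hx).2 i).2).trans_eq ?_
    rw [Finset.sum_const, Finset.card_univ, Fintype.card_fin, nsmul_eq_mul, hD]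
    ring
  have hcont : Continuous (lap (testFn c T p)) := continuous_finsetSum _ fun i _ =>
    (contDiff_partialD (contDiff_partialD (contDiff_testFn c T p) i) i).continuous
  rw [← integral_const_mul]
  have h1 : ∫ x, cellDiam T ^ 2 * |lap (testFn c T p) x| ∂(cellMeasure T) ≤
      ∫ _, n * (D * M) ∂(cellMeasure T) := by
    refine integral_mono_ae (integrable_cell_of_continuous T (continuous_const.mul hcont.abs))
      (integrable_const _) ?_
    exact (ae_restrict_iff' (isCompact_cell T).measurableSet).2 (ae_of_all _ hpt)
  refine h1.trans ?_
  rw [integral_const, smul_eq_mul]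
  have hD0 : 0 ≤ D := by positivity
  have hJ0 : 0 ≤ ∫ x, |peval p x| ∂(cellMeasure T) := integral_nonneg fun _ => abs_nonneg _
  calc _ ≤ cellDiam T ^ n * κ * (n * (D * M)) :=
        mul_le_mul_of_nonneg_right (measureReal_cell_le T hx₀) (by positivity)
    _ = n * D * κ * (cellDiam T ^ n * M) := by ring
    _ ≤ n * D * κ * (A₁ * ∫ x, |peval p x| ∂(cellMeasure T)) :=
        mul_le_mul_of_nonneg_left hMJ (by positivity)
    _ ≤ _ := by linarith

/-! ### Test functions and integration by parts -/

theorem continuous_partialD {f : Pt n → ℝ} (hf : ContDiff ℝ ∞ f) (i : Fin n) :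
    Continuous (partialD i f) :=
  (contDiff_partialD hf i).continuous

theorem continuous_lap {f : Pt n → ℝ} (hf : ContDiff ℝ ∞ f) : Continuous (lap f) :=
  continuous_finsetSum _ fun i _ => continuous_partialD (contDiff_partialD hf i) i

theorem continuous_gradient {f : Pt n → ℝ} (hf : ContDiff ℝ ∞ f) : Continuous (gradient f) :=
  (InnerProductSpace.toDual ℝ (Pt n)).symm.continuous.comp (hf.continuous_fderiv (by simp))

theorem partialD_eq_zero_of_notMem {φ : Pt n → ℝ} {x : Pt n} (hx : x ∉ tsupport φ) (i : Fin n) :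
    partialD i φ x = 0 := by
  rw [partialD, (notMem_tsupport_iff_eventuallyEq.1 hx).fderiv_eq]
  simp

theorem tsupport_partialD_subset (φ : Pt n → ℝ) (i : Fin n) :
    tsupport (partialD i φ) ⊆ tsupport φ :=
  closure_minimal (fun _ hx => by_contra fun h => hx (partialD_eq_zero_of_notMem h i))
    (isClosed_tsupport φ)

theorem lap_eq_zero_of_notMem {φ : Pt n → ℝ} {x : Pt n} (hx : x ∉ tsupport φ) : lap φ x = 0 :=
  Finset.sum_eq_zero fun i _ =>
    partialD_eq_zero_of_notMem (fun h => hx (tsupport_partialD_subset φ i h)) i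

theorem gradient_eq_zero_of_notMem {φ : Pt n → ℝ} {x : Pt n} (hx : x ∉ tsupport φ) :
    gradient φ x = 0 := by
  rw [gradient, (notMem_tsupport_iff_eventuallyEq.1 hx).fderiv_eq]
  simp

theorem hasCompactSupport_partialD {φ : Pt n → ℝ} (hφ : HasCompactSupport φ) (i : Fin n) :
    HasCompactSupport (partialD i φ) :=
  hφ.of_isClosed_subset (isClosed_tsupport _) (tsupport_partialD_subset φ i)

theorem hasCompactSupport_lap {φ : Pt n → ℝ} (hφ : HasCompactSupport φ) :
    HasCompactSupport (lap φ) :=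
  HasCompactSupport.intro' hφ (isClosed_tsupport φ) fun _ hx => lap_eq_zero_of_notMem hx

theorem hasCompactSupport_gradient {φ : Pt n → ℝ} (hφ : HasCompactSupport φ) :
    HasCompactSupport (gradient φ) :=
  HasCompactSupport.intro' hφ (isClosed_tsupport φ) fun _ hx => gradient_eq_zero_of_notMem hx

theorem inner_gradient_eq_sum (f : Pt n → ℝ) (w x : Pt n) :
    ⟪w, gradient f x⟫ = ∑ i, w i * partialD i f x := by
  have h1 : ⟪w, gradient f x⟫ = fderiv ℝ f x w := by
    rw [real_inner_comm, gradient, InnerProductSpace.toDual_symm_apply]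
  have h2 : w = ∑ i, w i • EuclideanSpace.single i (1 : ℝ) := by
    have := (EuclideanSpace.basisFun (Fin n) ℝ).sum_repr w
    simpa using this.symm
  rw [h1]
  conv_lhs => rw [h2]
  simp [partialD]

theorem gradient_apply (f : Pt n → ℝ) (x : Pt n) (i : Fin n) :
    gradient f x i = partialD i f x := by
  have h := inner_gradient_eq_sum f (EuclideanSpace.single i 1) x
  rw [EuclideanSpace.inner_single_left] at h
  simpa [Finset.sum_ite_eq, Pi.single_apply] using h

theorem integral_mul_partialD {f φ : Pt n → ℝ} (hf : ContDiff ℝ ∞ f) (hφ : ContDiff ℝ ∞ φ)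
    (hc : HasCompactSupport φ) (i : Fin n) :
    ∫ x, f x * partialD i φ x = -∫ x, partialD i f x * φ x :=
  integral_mul_fderiv_eq_neg_fderiv_mul_of_integrable
    (((continuous_partialD hf i).mul hφ.continuous).integrable_of_hasCompactSupport hc.mul_left)
    ((hf.continuous.mul (continuous_partialD hφ i)).integrable_of_hasCompactSupport
      (hasCompactSupport_partialD hc i).mul_left)
    ((hf.continuous.mul hφ.continuous).integrable_of_hasCompactSupport hc.mul_left)
    (fun x _ => hf.differentiable (by simp) x) (fun x _ => hφ.differentiable (by simp) x)

theorem integral_inner_gradient {f φ : Pt n → ℝ} (hf : ContDiff ℝ ∞ f) (hφ : ContDiff ℝ ∞ φ)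
    (hc : HasCompactSupport φ) :
    ∫ x, ⟪gradient f x, gradient φ x⟫ = -∫ x, f x * lap φ x := by
  simp only [inner_gradient_eq_sum, gradient_apply, lap, Finset.mul_sum]
  rw [integral_finsetSum, integral_finsetSum, ← Finset.sum_neg_distrib]
  · refine Finset.sum_congr rfl fun i _ => ?_
    rw [integral_mul_partialD hf (contDiff_partialD hφ i) (hasCompactSupport_partialD hc i), neg_neg]
  · exact fun i _ => (hf.continuous.mul (continuous_partialD (contDiff_partialD hφ i) i)
      ).integrable_of_hasCompactSupport
      (hasCompactSupport_partialD (hasCompactSupport_partialD hc i) i).mul_left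
  · exact fun i _ => ((continuous_partialD hf i).mul (continuous_partialD hφ i)
      ).integrable_of_hasCompactSupport (hasCompactSupport_partialD hc i).mul_left

theorem integral_lap_mul {f φ : Pt n → ℝ} (hf : ContDiff ℝ ∞ f) (hφ : ContDiff ℝ ∞ φ)
    (hc : HasCompactSupport φ) :
    ∫ x, lap f x * φ x = ∫ x, f x * lap φ x := by
  rw [← neg_inj, ← integral_inner_gradient hf hφ hc]
  simp only [inner_gradient_eq_sum, gradient_apply, lap, Finset.sum_mul]
  rw [integral_finsetSum, integral_finsetSum, ← Finset.sum_neg_distrib]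
  · refine Finset.sum_congr rfl fun i _ => ?_
    rw [integral_mul_partialD (contDiff_partialD hf i) hφ hc]
  · exact fun i _ => ((continuous_partialD hf i).mul (continuous_partialD hφ i)
      ).integrable_of_hasCompactSupport (hasCompactSupport_partialD hc i).mul_left
  · exact fun i _ => ((continuous_partialD (contDiff_partialD hf i) i).mul hφ.continuous
      ).integrable_of_hasCompactSupport hc.mul_left

/-! ### Functions in `H₀¹(Ω)` -/

theorem isH10_of_contDiff {Ω : Set (Pt n)} {φ : Pt n → ℝ} (hφ : ContDiff ℝ ∞ φ)
    (hc : HasCompactSupport φ) (hsub : tsupport φ ⊆ Ω) : IsH10 Ω φ (gradient φ) where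
  memLp := (hφ.continuous.memLp_of_hasCompactSupport hc).restrict Ω
  memLp_grad := ((continuous_gradient hφ).memLp_of_hasCompactSupport
    (hasCompactSupport_gradient hc)).restrict Ω
  approx := ⟨fun _ => φ, fun _ => ⟨hφ, hc, hsub⟩, by simp, by simp⟩

/-- On a finite measure space the `L²` norm controls the `L¹` norm. This passes to the limit in
integrals against a bounded factor. -/
theorem tendsto_integral_zero_of_eLpNorm_two {α E : Type*} [MeasurableSpace α]
    [NormedAddCommGroup E] {μ : Measure α} [IsFiniteMeasure μ] {w : ℕ → α → E} {F : ℕ → α → ℝ}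
    {M : ℝ} (hF : ∀ k x, ‖F k x‖ ≤ M * ‖w k x‖) (hw : ∀ k, AEStronglyMeasurable (w k) μ)
    (h : Tendsto (fun k => eLpNorm (w k) 2 μ) atTop (𝓝 0)) :
    Tendsto (fun k => ∫ x, F k x ∂μ) atTop (𝓝 0) := by
  rw [tendsto_zero_iff_enorm_tendsto_zero]
  have hfin : μ Set.univ ^ (1 / (1 : ℝ≥0∞).toReal - 1 / (2 : ℝ≥0∞).toReal) ≠ ⊤ :=
    ENNReal.rpow_ne_top_of_nonneg (by simp; norm_num) (measure_ne_top _ _)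
  have hlim := ENNReal.Tendsto.const_mul (a := ENNReal.ofReal M)
    (ENNReal.Tendsto.mul_const h (Or.inr hfin)) (Or.inr ENNReal.ofReal_ne_top)
  rw [zero_mul, mul_zero] at hlim
  refine tendsto_of_tendsto_of_tendsto_of_le_of_le tendsto_const_nhds hlim (fun _ => zero_le)
    fun k => ?_
  calc ‖∫ x, F k x ∂μ‖ₑ ≤ ∫⁻ x, ‖F k x‖ₑ ∂μ := enorm_integral_le_lintegral_enorm _
    _ = eLpNorm (F k) 1 μ := eLpNorm_one_eq_lintegral_enorm.symm
    _ ≤ ENNReal.ofReal M * eLpNorm (w k) 1 μ :=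
        eLpNorm_le_mul_eLpNorm_of_ae_le_mul (ae_of_all _ (hF k)) 1
    _ ≤ _ := by
        gcongr
        exact eLpNorm_le_eLpNorm_mul_rpow_measure_univ (by norm_num) (hw k)

theorem integrable_mul_of_continuous_hasCompactSupport {μ : Measure (Pt n)} {v L : Pt n → ℝ}
    (hv : Integrable v μ) (hL : Continuous L) (hc : HasCompactSupport L) :
    Integrable (fun x => v x * L x) μ := by
  obtain ⟨C, hC⟩ := hL.bounded_above_of_compact_support hc
  exact hv.mul_bdd (c := C) hL.aestronglyMeasurable (ae_of_all _ hC)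

theorem integrable_inner_of_continuous_hasCompactSupport {μ : Measure (Pt n)} {v L : Pt n → Pt n}
    (hv : Integrable v μ) (hL : Continuous L) (hc : HasCompactSupport L) :
    Integrable (fun x => ⟪v x, L x⟫) μ := by
  obtain ⟨C, hC⟩ := hL.bounded_above_of_compact_support hc
  refine (hv.norm.mul_const C).mono' (hv.aestronglyMeasurable.inner hL.aestronglyMeasurable)
    (ae_of_all _ fun x => (norm_inner_le_norm _ _).trans ?_)
  exact mul_le_mul_of_nonneg_left (hC x) (norm_nonneg _)

/-- The gradient of a function in `H₀¹(Ω)` is its distributional gradient. -/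
theorem IsH10.integral_inner_gradient {Ω : Set (Pt n)} (hΩ : Bornology.IsBounded Ω)
    {u : Pt n → ℝ} {g : Pt n → Pt n} (hu : IsH10 Ω u g) {φ : Pt n → ℝ} (hφ : ContDiff ℝ ∞ φ)
    (hc : HasCompactSupport φ) (hsub : tsupport φ ⊆ Ω) :
    ∫ x in Ω, ⟪g x, gradient φ x⟫ = -∫ x in Ω, u x * lap φ x := by
  have : IsFiniteMeasure (volume.restrict Ω) := ⟨by simpa using hΩ.measure_lt_top⟩
  obtain ⟨ψ, hψ, h1, h2⟩ := hu.approx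
  have cg := continuous_gradient hφ
  have sg := hasCompactSupport_gradient hc
  have cl := continuous_lap hφ
  have sl := hasCompactSupport_lap hc
  obtain ⟨C₁, hC₁⟩ := cg.bounded_above_of_compact_support sg
  obtain ⟨C₂, hC₂⟩ := cl.bounded_above_of_compact_support sl
  have iu : Integrable u (volume.restrict Ω) := hu.memLp.integrable (by norm_num)
  have ig : Integrable g (volume.restrict Ω) := hu.memLp_grad.integrable (by norm_num)
  have mψ : ∀ k, Integrable (ψ k) (volume.restrict Ω) := fun k =>
    ((hψ k).1.continuous.integrable_of_hasCompactSupport (hψ k).2.1).restrict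
  have mg : ∀ k, Integrable (gradient (ψ k)) (volume.restrict Ω) := fun k =>
    ((continuous_gradient (hψ k).1).integrable_of_hasCompactSupport
      (hasCompactSupport_gradient (hψ k).2.1)).restrict
  have t1 : Tendsto (fun k => ∫ x in Ω, ⟪gradient (ψ k) x, gradient φ x⟫) atTop
      (𝓝 (∫ x in Ω, ⟪g x, gradient φ x⟫)) := by
    have h := tendsto_integral_zero_of_eLpNorm_two (μ := volume.restrict Ω) (M := C₁)
      (F := fun k x => ⟪gradient (ψ k) x - g x, gradient φ x⟫) (fun k x =>
        (norm_inner_le_norm _ _).trans (by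
          rw [mul_comm]; exact mul_le_mul_of_nonneg_right (hC₁ x) (norm_nonneg _)))
      (fun k => ((mg k).sub ig).aestronglyMeasurable) h2
    have e : ∀ k, ∫ x in Ω, ⟪gradient (ψ k) x - g x, gradient φ x⟫ =
        (∫ x in Ω, ⟪gradient (ψ k) x, gradient φ x⟫) - ∫ x in Ω, ⟪g x, gradient φ x⟫ := fun k => by
      rw [← integral_sub (integrable_inner_of_continuous_hasCompactSupport (mg k) cg sg)
        (integrable_inner_of_continuous_hasCompactSupport ig cg sg)]
      simp only [inner_sub_left]
    simp only [e] at h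
    exact tendsto_sub_nhds_zero_iff.1 h
  have t2 : Tendsto (fun k => ∫ x in Ω, ψ k x * lap φ x) atTop
      (𝓝 (∫ x in Ω, u x * lap φ x)) := by
    have h := tendsto_integral_zero_of_eLpNorm_two (μ := volume.restrict Ω) (M := C₂)
      (F := fun k x => (ψ k x - u x) * lap φ x) (fun k x => by
          rw [norm_mul, mul_comm]; exact mul_le_mul_of_nonneg_right (hC₂ x) (norm_nonneg _))
      (fun k => ((mψ k).sub iu).aestronglyMeasurable) h1
    have e : ∀ k, ∫ x in Ω, (ψ k x - u x) * lap φ x =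
        (∫ x in Ω, ψ k x * lap φ x) - ∫ x in Ω, u x * lap φ x := fun k => by
      rw [← integral_sub (integrable_mul_of_continuous_hasCompactSupport (mψ k) cl sl)
        (integrable_mul_of_continuous_hasCompactSupport iu cl sl)]
      simp only [sub_mul]
    simp only [e] at h
    exact tendsto_sub_nhds_zero_iff.1 h
  -- The approximants satisfy the identity exactly, by classical integration by parts on the whole
  -- space.
  refine tendsto_nhds_unique t1 ?_
  refine t2.neg.congr fun k => ?_
  have e := ConvDiff.integral_inner_gradient (hψ k).1 hφ hc
  rw [setIntegral_eq_integral_of_forall_compl_eq_zero fun x hx => ?_,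
    setIntegral_eq_integral_of_forall_compl_eq_zero fun x hx => ?_, e]
  · rw [gradient_eq_zero_of_notMem fun h => hx (hsub h), inner_zero_right]
  · rw [lap_eq_zero_of_notMem fun h => hx (hsub h), mul_zero]

/-! ### Coefficients -/

/-- Regularity on the closure supplies, near each of its points, a local derivative `a'` that is
continuous within the closure and hence locally bounded. At points of the open set `U` the closure
is a neighbourhood, so `a'` agrees with the Fréchet derivative there. Compactness makes the bound
global. -/
theorem exists_bound_fderiv {E F : Type*} [NormedAddCommGroup E] [NormedSpace ℝ E]
    [NormedAddCommGroup F] [NormedSpace ℝ F] {U : Set E} (hU : IsOpen U)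
    (hc : IsCompact (closure U)) {a : E → F} (ha : ContDiffOn ℝ 1 a (closure U)) :
    ∃ C : ℝ, ∀ x ∈ U, ‖fderiv ℝ a x‖ ≤ C := by
  suffices ∃ C : ℝ, ∀ x ∈ closure U ∩ U, ‖fderiv ℝ a x‖ ≤ C by
    obtain ⟨C, hC⟩ := this
    exact ⟨C, fun x hx => hC x ⟨subset_closure hx, hx⟩⟩
  refine hc.induction_on (p := fun S => ∃ C : ℝ, ∀ x ∈ S ∩ U, ‖fderiv ℝ a x‖ ≤ C) ⟨0, by simp⟩
    (fun S S' hS ⟨C, hC⟩ => ⟨C, fun x hx => hC x ⟨hS hx.1, hx.2⟩⟩) ?_ ?_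
  · rintro S S' ⟨C, hC⟩ ⟨C', hC'⟩
    refine ⟨max C C', fun x hx => ?_⟩
    rcases hx.1 with h | h
    · exact (hC x ⟨h, hx.2⟩).trans (le_max_left _ _)
    · exact (hC' x ⟨h, hx.2⟩).trans (le_max_right _ _)
  · intro x hx
    have hax : ContDiffWithinAt ℝ (0 + 1) a (closure U) x := by simpa using ha x hx
    obtain ⟨v, hv, -, a', ha', hcont⟩ :=
      (contDiffWithinAt_succ_iff_hasFDerivWithinAt (by simp)).1 hax
    rw [Set.insert_eq_of_mem hx] at hv
    have hxv : x ∈ v := mem_of_mem_nhdsWithin hx hv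
    have hb : ∀ᶠ y in 𝓝[v] x, ‖a' y‖ ≤ ‖a' x‖ + 1 := by
      have := hcont.continuousWithinAt.norm.eventually_le_const (lt_add_one ‖a' x‖)
      exact this
    have hvK : 𝓝[closure U] x ≤ 𝓝[v] x :=
      le_inf inf_le_left (le_principal_iff.2 hv)
    refine ⟨{y | ‖a' y‖ ≤ ‖a' x‖ + 1} ∩ {y | v ∈ 𝓝[closure U] y},
      inter_mem (hvK hb) ?_, ‖a' x‖ + 1, fun y hy => ?_⟩
    · exact eventually_eventually_nhdsWithin.2 hv
    · have hvy : v ∈ 𝓝 y := by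
        have h1 : closure U ∈ 𝓝 y := mem_of_superset (hU.mem_nhds hy.2) subset_closure
        have h2 := hy.1.2
        rwa [Set.mem_ofPred_eq, nhdsWithin_eq_nhds.2 h1] at h2
      rw [((ha' y (mem_of_mem_nhds hvy)).hasFDerivAt hvy).fderiv]
      exact hy.1.1

theorem abs_divg_le (F : Pt n → Pt n) (x : Pt n) : |divg F x| ≤ n * ‖fderiv ℝ F x‖ := by
  rw [divg]
  refine (Finset.abs_sum_le_sum_abs _ _).trans ?_
  refine (Finset.sum_le_card_nsmul _ _ ‖fderiv ℝ F x‖ fun i _ => ?_).trans_eq (by simp)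
  refine (PiLp.norm_apply_le (fderiv ℝ F x (EuclideanSpace.single i 1)) i).trans ?_
  simpa using (fderiv ℝ F x).le_opNorm (EuclideanSpace.single i 1)

theorem continuousOn_divg {U : Set (Pt n)} (hU : IsOpen U) {F : Pt n → Pt n}
    (hF : ContDiffOn ℝ 1 F U) : ContinuousOn (divg F) U := by
  have h := hF.continuousOn_fderiv_of_isOpen hU le_rfl
  refine continuousOn_finsetSum _ fun i _ => ?_
  exact (EuclideanSpace.proj i : Pt n →L[ℝ] ℝ).continuous.comp_continuousOn
    (h.clm_apply continuousOn_const)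

/-- The boundary of a convex set is null. Derivatives may therefore be treated as if only interior
points existed. -/
theorem cellMeasure_eq (T : Simp n) : cellMeasure T = volume.restrict (interior (cell T)) :=
  (Measure.restrict_congr_set (interior_ae_eq_of_null_frontier
    ((convex_convexHull ℝ (Set.range T)).addHaar_frontier volume))).symm

theorem laplacian_eq_lap {f : Pt n → ℝ} (hf : ContDiff ℝ ∞ f) (x : Pt n) :
    Laplacian.laplacian f x = lap f x := by
  rw [InnerProductSpace.laplacian_eq_iteratedFDeriv_orthonormalBasis f
    (EuclideanSpace.basisFun (Fin n) ℝ)]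
  refine Finset.sum_congr rfl fun i _ => ?_
  rw [iteratedFDeriv_two_apply, partialD]
  have h : DifferentiableAt ℝ (fderiv ℝ f) x :=
    (hf.fderiv_right (m := ∞) (by simp)).differentiable (by simp) x
  have : partialD i f = fun y => fderiv ℝ f y (EuclideanSpace.single i 1) := rfl
  rw [this, fderiv_clm_apply h (differentiableAt_const _)]
  simp

theorem divg_smul {f : Pt n → ℝ} {F : Pt n → Pt n} {x : Pt n} (hf : DifferentiableAt ℝ f x)
    (hF : DifferentiableAt ℝ F x) :
    divg (fun y => f y • F y) x = f x * divg F x + ⟪F x, gradient f x⟫ := by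
  rw [inner_gradient_eq_sum, divg, divg, fderiv_fun_smul hf hF, Finset.mul_sum,
    ← Finset.sum_add_distrib]
  refine Finset.sum_congr rfl fun i _ => ?_
  simp [partialD, mul_comm]

/-! ### The error identity on a simplex -/

theorem ae_mem_interior_cell (T : Simp n) : ∀ᵐ x ∂(cellMeasure T), x ∈ interior (cell T) := by
  rw [cellMeasure_eq]
  exact ae_restrict_mem isOpen_interior.measurableSet

theorem ae_mem_cell (T : Simp n) : ∀ᵐ x ∂(cellMeasure T), x ∈ cell T :=
  ae_restrict_mem (isCompact_cell T).measurableSet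

theorem integrable_cell_of_continuousOn (T : Simp n) {w : Pt n → ℝ}
    (hw : ContinuousOn w (cell T)) : Integrable w (cellMeasure T) :=
  hw.integrableOn_compact (isCompact_cell T)

theorem Integrable.mul_continuousOn_cell {T : Simp n} {v w : Pt n → ℝ}
    (hv : Integrable v (cellMeasure T)) (hw : ContinuousOn w (cell T)) :
    Integrable (fun x => v x * w x) (cellMeasure T) := by
  obtain ⟨C, hC⟩ := (isCompact_cell T).exists_bound_of_continuousOn hw
  refine hv.mul_bdd (c := C) (hw.aestronglyMeasurable (isCompact_cell T).measurableSet) ?_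
  filter_upwards [ae_mem_cell T] with x hx using hC x hx

theorem Integrable.inner_continuousOn_cell {T : Simp n} {v w : Pt n → Pt n}
    (hv : Integrable v (cellMeasure T)) (hw : ContinuousOn w (cell T)) :
    Integrable (fun x => ⟪w x, v x⟫) (cellMeasure T) := by
  obtain ⟨C, hC⟩ := (isCompact_cell T).exists_bound_of_continuousOn hw
  refine (hv.norm.const_mul C).mono'
    ((hw.aestronglyMeasurable (isCompact_cell T).measurableSet).inner hv.aestronglyMeasurable) ?_
  filter_upwards [ae_mem_cell T] with x hx
  exact (norm_inner_le_norm _ _).trans (mul_le_mul_of_nonneg_right (hC x hx) (norm_nonneg _))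

/-- Regularity of the coefficients and of the error on the simplex `T`. -/
structure CellRegular (Ω : Set (Pt n)) (T : Simp n) (a : Pt n → Pt n) (b f u : Pt n → ℝ)
    (g : Pt n → Pt n) (uh : Pt n → ℝ) (p : MvPolynomial (Fin n) ℝ) (Ca : ℝ) : Prop where
  isOpen : IsOpen Ω
  isBounded : Bornology.IsBounded Ω
  interior_subset : interior (cell T) ⊆ Ω
  contDiffOn : ContDiffOn ℝ 1 a Ω
  cont_a : ContinuousOn a (cell T)
  cont_b : ContinuousOn b (cell T)
  cont_f : ContinuousOn f (cell T)
  divg_le : ∀ x ∈ Ω, |divg a x| ≤ Ca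
  b_le : ∀ x ∈ cell T, |b x| ≤ Ca
  isH10 : IsH10 Ω u g
  eq_poly : ∀ x ∈ cell T, uh x = peval p x

namespace CellRegular

variable {Ω : Set (Pt n)} {T : Simp n} {a : Pt n → Pt n} {b f u : Pt n → ℝ}
  {g : Pt n → Pt n} {uh : Pt n → ℝ} {p : MvPolynomial (Fin n) ℝ} {Ca : ℝ}

theorem cellMeasure_le (h : CellRegular Ω T a b f u g uh p Ca) :
    cellMeasure T ≤ volume.restrict Ω := by
  rw [cellMeasure_eq]
  exact Measure.restrict_mono h.interior_subset le_rfl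

theorem integrable_u (h : CellRegular Ω T a b f u g uh p Ca) : Integrable u (cellMeasure T) :=
  (h.isH10.memLp.mono_measure h.cellMeasure_le).integrable (by norm_num)

theorem integrable_g (h : CellRegular Ω T a b f u g uh p Ca) : Integrable g (cellMeasure T) :=
  (h.isH10.memLp_grad.mono_measure h.cellMeasure_le).integrable (by norm_num)

theorem aestronglyMeasurable_divg (h : CellRegular Ω T a b f u g uh p Ca) :
    AEStronglyMeasurable (divg a) (cellMeasure T) := by
  rw [cellMeasure_eq]
  exact ((continuousOn_divg h.isOpen h.contDiffOn).mono h.interior_subset).aestronglyMeasurable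
    isOpen_interior.measurableSet

theorem ae_divg_le (h : CellRegular Ω T a b f u g uh p Ca) :
    ∀ᵐ x ∂(cellMeasure T), ‖divg a x‖ ≤ Ca := by
  filter_upwards [ae_mem_interior_cell T] with x hx using h.divg_le x (h.interior_subset hx)

theorem integrable_divg_mul (h : CellRegular Ω T a b f u g uh p Ca) {v : Pt n → ℝ}
    (hv : Integrable v (cellMeasure T)) :
    Integrable (fun x => divg a x * v x) (cellMeasure T) :=
  hv.bdd_mul (c := Ca) h.aestronglyMeasurable_divg h.ae_divg_le

theorem uh_eventuallyEq (h : CellRegular Ω T a b f u g uh p Ca) {x : Pt n}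
    (hx : x ∈ interior (cell T)) : uh =ᶠ[𝓝 x] peval p := by
  filter_upwards [mem_interior_iff_mem_nhds.1 hx] with y hy using h.eq_poly y hy

theorem residual_eq (h : CellRegular Ω T a b f u g uh p Ca) (ε : ℝ) {x : Pt n}
    (hx : x ∈ interior (cell T)) :
    residual ε a b f uh x = -ε * lap (peval p) x +
      (divg a x * peval p x + ⟪a x, gradient (peval p) x⟫) + peval p x * b x - f x := by
  have he := h.uh_eventuallyEq hx
  have hda : DifferentiableAt ℝ a x :=
    (h.contDiffOn.differentiableOn (by simp)).differentiableAt
      (h.isOpen.mem_nhds (h.interior_subset hx))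
  have h1 : divg (fun y => uh y • a y) x = divg (fun y => peval p y • a y) x := by
    have : (fun y => uh y • a y) =ᶠ[𝓝 x] fun y => peval p y • a y := by
      filter_upwards [he] with y hy using by rw [hy]
    rw [divg, divg, this.fderiv_eq]
  rw [residual, (InnerProductSpace.laplacian_congr_nhds he).eq_of_nhds,
    laplacian_eq_lap (contDiff_peval p), h1, divg_smul (differentiable_peval p x) hda,
    he.eq_of_nhds]
  ring

theorem convError_eq (h : CellRegular Ω T a b f u g uh p Ca) {x : Pt n}
    (hx : x ∈ interior (cell T)) :
    convError a g uh x = ⟪a x, g x⟫ - ⟪a x, gradient (peval p) x⟫ := by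
  rw [convError, inner_sub_right, gradient, (h.uh_eventuallyEq hx).fderiv_eq, gradient]

theorem integrable_inner_gradient (h : CellRegular Ω T a b f u g uh p Ca) :
    Integrable (fun x => ⟪a x, gradient (peval p) x⟫) (cellMeasure T) :=
  integrable_cell_of_continuousOn T
    (ContinuousOn.inner h.cont_a (continuous_gradient (contDiff_peval p)).continuousOn)

theorem integrable_residual (h : CellRegular Ω T a b f u g uh p Ca) (ε : ℝ) :
    Integrable (residual ε a b f uh) (cellMeasure T) := by
  have hp := integrable_cell_of_continuous T (continuous_peval p)
  have := ((((integrable_cell_of_continuous T (continuous_lap (contDiff_peval p))).const_mul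
    (-ε)).add ((h.integrable_divg_mul hp).add h.integrable_inner_gradient)).add
    (Integrable.mul_continuousOn_cell hp h.cont_b)).sub
    (integrable_cell_of_continuousOn T h.cont_f)
  refine this.congr ?_
  filter_upwards [ae_mem_interior_cell T] with x hx using (h.residual_eq ε hx).symm

theorem integrable_convError (h : CellRegular Ω T a b f u g uh p Ca) :
    Integrable (convError a g uh) (cellMeasure T) := by
  refine ((Integrable.inner_continuousOn_cell h.integrable_g h.cont_a).sub
    h.integrable_inner_gradient).congr ?_
  filter_upwards [ae_mem_interior_cell T] with x hx using (h.convError_eq hx).symm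

/-- The error equation tested with a smooth function supported in the interior of `T`. -/
theorem integral_residual_mul (h : CellRegular Ω T a b f u g uh p Ca) {ε : ℝ}
    (hu : IsWeakSolution Ω ε a b f u g) {φ : Pt n → ℝ} (hφ : ContDiff ℝ ∞ φ)
    (hc : HasCompactSupport φ) (hsub : tsupport φ ⊆ interior (cell T)) :
    ∫ x, residual ε a b f uh x * φ x ∂(cellMeasure T) +
        ∫ x, convError a g uh x * φ x ∂(cellMeasure T) =
      ε * ∫ x, (u x - uh x) * lap φ x ∂(cellMeasure T) -
        ∫ x, (divg a x + b x) * (u x - uh x) * φ x ∂(cellMeasure T) := by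
  have key : ∀ {F : Pt n → ℝ}, (∀ x, x ∉ tsupport φ → F x = 0) →
      ∫ x in Ω, F x = ∫ x, F x ∂(cellMeasure T) := fun {F} hF => by
    rw [cellMeasure, setIntegral_eq_integral_of_forall_compl_eq_zero fun x hx => hF x fun h' =>
      hx (h.interior_subset (hsub h')), setIntegral_eq_integral_of_forall_compl_eq_zero
      fun x hx => hF x fun h' => hx (_root_.interior_subset (hsub h'))]
  have key' : ∀ {F : Pt n → ℝ}, (∀ x, x ∉ tsupport φ → F x = 0) →
      ∫ x, F x ∂(cellMeasure T) = ∫ x, F x := fun {F} hF => by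
    rw [cellMeasure, setIntegral_eq_integral_of_forall_compl_eq_zero
      fun x hx => hF x fun h' => hx (_root_.interior_subset (hsub h'))]
  have hφ0 : ∀ x, x ∉ tsupport φ → φ x = 0 := fun x hx => image_eq_zero_of_notMem_tsupport hx
  have hsubΩ := hsub.trans h.interior_subset
  have E1 := hu.weak φ (gradient φ) (isH10_of_contDiff hφ hc hsubΩ)
  rw [h.isH10.integral_inner_gradient h.isBounded hφ hc hsubΩ,
    key (fun x hx => by rw [lap_eq_zero_of_notMem hx, mul_zero]),
    key (fun x hx => by rw [hφ0 x hx, mul_zero]),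
    key (fun x hx => by rw [hφ0 x hx, mul_zero])] at E1
  -- The polynomial `p` is smooth on the whole space and `φ` is supported inside `T`, so no boundary
  -- terms arise.
  have E3 : ∫ x, lap (peval p) x * φ x ∂(cellMeasure T) =
      ∫ x, peval p x * lap φ x ∂(cellMeasure T) := by
    rw [key' (fun x hx => by rw [hφ0 x hx, mul_zero]),
      key' (fun x hx => by rw [lap_eq_zero_of_notMem hx, mul_zero]),
      integral_lap_mul (contDiff_peval p) hφ hc]
  have mφ : ∀ {v : Pt n → ℝ}, Integrable v (cellMeasure T) →
      Integrable (fun x => v x * φ x) (cellMeasure T) := fun hv =>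
    integrable_mul_of_continuous_hasCompactSupport hv hφ.continuous hc
  have mL : ∀ {v : Pt n → ℝ}, Integrable v (cellMeasure T) →
      Integrable (fun x => v x * lap φ x) (cellMeasure T) := fun hv =>
    integrable_mul_of_continuous_hasCompactSupport hv (continuous_lap hφ) (hasCompactSupport_lap hc)
  have ip := integrable_cell_of_continuous T (continuous_peval p)
  have iup : Integrable (fun x => u x - uh x) (cellMeasure T) := by
    refine (h.integrable_u.sub ip).congr ?_
    filter_upwards [ae_mem_cell T] with x hx
    rw [Pi.sub_apply, h.eq_poly x hx]
  have iD : Integrable (fun x => (divg a x + b x) * (u x - uh x)) (cellMeasure T) := by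
    refine ((h.integrable_divg_mul iup).add (Integrable.mul_continuousOn_cell iup h.cont_b)).congr
      (ae_of_all _ fun x => ?_)
    simp only [Pi.add_apply]; ring
  have iA : Integrable (fun x => ⟪a x, g x⟫ + divg a x * u x + b x * u x) (cellMeasure T) := by
    refine (((Integrable.inner_continuousOn_cell h.integrable_g h.cont_a).add
      (h.integrable_divg_mul h.integrable_u)).add
      (Integrable.mul_continuousOn_cell h.integrable_u h.cont_b)).congr (ae_of_all _ fun x => ?_)
    simp only [Pi.add_apply]; ring
  have il := integrable_cell_of_continuous T (continuous_lap (contDiff_peval p))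
  have if' := integrable_cell_of_continuousOn T h.cont_f
  have E4 : ∫ x, (u x - uh x) * lap φ x ∂(cellMeasure T) =
      ∫ x, u x * lap φ x ∂(cellMeasure T) - ∫ x, peval p x * lap φ x ∂(cellMeasure T) := by
    rw [← integral_sub (mL h.integrable_u) (mL ip)]
    refine integral_congr_ae ?_
    filter_upwards [ae_mem_cell T] with x hx
    rw [h.eq_poly x hx]; ring
  -- Pointwise, the derivatives of `a u_h` in the residual cancel against the `u_h` parts of the
  -- other two terms; only `Δp` and the weak form of `u` remain.
  have E5 : ∫ x, residual ε a b f uh x * φ x ∂(cellMeasure T) +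
        ∫ x, convError a g uh x * φ x ∂(cellMeasure T) +
        ∫ x, (divg a x + b x) * (u x - uh x) * φ x ∂(cellMeasure T) =
      -ε * ∫ x, lap (peval p) x * φ x ∂(cellMeasure T) +
        ∫ x, (⟪a x, g x⟫ + divg a x * u x + b x * u x) * φ x ∂(cellMeasure T) -
        ∫ x, f x * φ x ∂(cellMeasure T) := by
    have s1 : Integrable (fun x => residual ε a b f uh x * φ x + convError a g uh x * φ x)
        (cellMeasure T) := (mφ (h.integrable_residual ε)).add (mφ h.integrable_convError)
    have s2 : Integrable (fun x => -ε * (lap (peval p) x * φ x) +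
        (⟪a x, g x⟫ + divg a x * u x + b x * u x) * φ x) (cellMeasure T) :=
      ((mφ il).const_mul _).add (mφ iA)
    rw [← integral_const_mul,
      ← integral_add (mφ (h.integrable_residual ε)) (mφ h.integrable_convError),
      ← integral_add s1 (mφ iD), ← integral_add ((mφ il).const_mul _) (mφ iA),
      ← integral_sub s2 (mφ if')]
    refine integral_congr_ae ?_
    filter_upwards [ae_mem_interior_cell T] with x hx
    rw [h.residual_eq ε hx, h.convError_eq hx, h.eq_poly x (_root_.interior_subset hx)]
    ring
  rw [E3] at E5
  rw [E4]
  linarith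

/-- Dominated convergence: the cutoff factors lie between `0` and `1` on `T`. -/
theorem tendsto_integral_mul_testFn {w : Pt n → ℝ} (hw : Integrable w (cellMeasure T))
    (ψ : MvPolynomial (Fin n) ℝ) :
    Tendsto (fun k : ℕ => ∫ x, w x * testFn (k + 1) T ψ x ∂(cellMeasure T)) atTop
      (𝓝 (∫ x, bubble T x * peval ψ x * w x ∂(cellMeasure T))) := by
  refine tendsto_integral_of_dominated_convergence (fun x => |w x * peval ψ x|)
    (fun k => hw.aestronglyMeasurable.mul (contDiff_testFn _ T ψ).continuous.aestronglyMeasurable)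
    (Integrable.mul_continuousOn_cell hw (continuous_peval ψ).continuousOn).abs (fun k => ?_) ?_
  · filter_upwards [ae_mem_cell T] with x hx
    rw [norm_mul, abs_mul]
    exact mul_le_mul_of_nonneg_left (abs_testFn_le (by positivity) T ψ hx) (abs_nonneg _)
  · filter_upwards [ae_mem_cell T] with x hx
    rw [mul_comm _ (w x)]
    exact (tendsto_testFn T ψ hx).const_mul _

/-- The error equation tested with `b_T ψ`, estimated by the sup norm of the error. -/
theorem abs_integral_bubble_le (h : CellRegular Ω T a b f u g uh p Ca) {ε : ℝ} (hε : 0 < ε)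
    (hu : IsWeakSolution Ω ε a b f u g) (hh : 0 < cellDiam T) {A E : ℝ} (hE : 0 ≤ E)
    (he : ∀ᵐ x ∂(cellMeasure T), |u x - uh x| ≤ E) (ψ : MvPolynomial (Fin n) ℝ)
    (hψ : ∀ c : ℝ, 0 < c → cellDiam T ^ 2 * ∫ x, |lap (testFn c T ψ) x| ∂(cellMeasure T) ≤
          A * ∫ x, |peval ψ x| ∂(cellMeasure T)) :
    |∫ x, bubble T x * peval ψ x * residual ε a b f uh x ∂(cellMeasure T) +
        ∫ x, bubble T x * peval ψ x * convError a g uh x ∂(cellMeasure T)| ≤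
      (ε * A / cellDiam T ^ 2 + 2 * Ca) * E * ∫ x, |peval ψ x| ∂(cellMeasure T) := by
  have hlim := ((tendsto_integral_mul_testFn (h.integrable_residual ε) ψ).add
    (tendsto_integral_mul_testFn h.integrable_convError ψ)).abs
  -- The bound does not depend on the cutoff parameter, so it suffices to prove it for each smooth
  -- test function.
  refine le_of_tendsto hlim (Eventually.of_forall fun k => ?_)
  have hc : (0 : ℝ) < k + 1 := by positivity
  set φ := testFn (k + 1 : ℝ) T ψ with hφ
  have cφ : ContDiff ℝ ∞ φ := contDiff_testFn _ T ψ
  rw [h.integral_residual_mul hu cφ (hasCompactSupport_testFn hc T ψ)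
    (tsupport_testFn_subset hc T ψ)]
  set J := ∫ x, |peval ψ x| ∂(cellMeasure T) with hJ
  have B1 : |∫ x, (u x - uh x) * lap φ x ∂(cellMeasure T)| ≤ E * (A * J / cellDiam T ^ 2) := by
    have h1 : |∫ x, (u x - uh x) * lap φ x ∂(cellMeasure T)| ≤
        ∫ x, E * |lap φ x| ∂(cellMeasure T) := by
      rw [← Real.norm_eq_abs]
      refine norm_integral_le_of_norm_le
        ((integrable_cell_of_continuous T (continuous_lap cφ).abs).const_mul E) ?_
      filter_upwards [he] with x hx
      rw [norm_mul]
      exact mul_le_mul_of_nonneg_right hx (abs_nonneg _)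
    rw [integral_const_mul] at h1
    refine h1.trans (mul_le_mul_of_nonneg_left ?_ hE)
    rw [le_div_iff₀ (by positivity), mul_comm]
    exact hψ _ hc
  have B2 : |∫ x, (divg a x + b x) * (u x - uh x) * φ x ∂(cellMeasure T)| ≤ 2 * Ca * E * J := by
    rw [hJ, ← integral_const_mul, ← Real.norm_eq_abs]
    refine norm_integral_le_of_norm_le
      ((integrable_cell_of_continuous T (continuous_peval ψ).abs).const_mul _) ?_
    filter_upwards [he, h.ae_divg_le, ae_mem_cell T] with x hx h2 h3
    rw [norm_mul, norm_mul]
    have h4 : ‖divg a x + b x‖ ≤ 2 * Ca := by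
      have := norm_add_le (divg a x) (b x)
      have h5 := h.b_le x h3
      rw [← Real.norm_eq_abs] at h5
      linarith
    have h6 : 0 ≤ 2 * Ca := (norm_nonneg _).trans h4
    exact mul_le_mul (mul_le_mul h4 hx (norm_nonneg _) h6) (abs_testFn_le hc T ψ h3)
      (norm_nonneg _) (mul_nonneg h6 hE)
  refine (abs_sub _ _).trans ?_
  rw [abs_mul, abs_of_pos hε]
  have := mul_le_mul_of_nonneg_left B1 hε.le
  have e : (ε * A / cellDiam T ^ 2 + 2 * Ca) * E * J =
    ε * (E * (A * J / cellDiam T ^ 2)) + 2 * Ca * E * J := by ring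
  rw [e]
  linarith

end CellRegular

/-! ### Duality with bubble-weighted polynomials -/

theorem eLpNorm_one_peval (T : Simp n) (ψ : MvPolynomial (Fin n) ℝ) :
    eLpNorm (peval ψ) 1 (cellMeasure T) =
      ENNReal.ofReal (∫ x, |peval ψ x| ∂(cellMeasure T)) := by
  rw [eLpNorm_one_eq_lintegral_enorm]
  exact (ofReal_integral_norm_eq_lintegral_enorm
    (integrable_cell_of_continuous T (continuous_peval ψ))).symm

theorem ofReal_abs_integral_bubble_le (T : Simp n) (ψ : MvPolynomial (Fin n) ℝ)
    (w : Pt n → ℝ) :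
    ENNReal.ofReal |∫ x, bubble T x * peval ψ x * w x ∂(cellMeasure T)| ≤
      supNorm T w * eLpNorm (peval ψ) 1 (cellMeasure T) := by
  rw [← Real.enorm_eq_ofReal_abs, eLpNorm_one_eq_lintegral_enorm]
  refine (enorm_integral_le_lintegral_enorm _).trans ?_
  rw [← lintegral_const_mul _ (continuous_peval ψ).enorm.measurable]
  refine lintegral_mono_ae ?_
  filter_upwards [ae_mem_cell T, ae_le_eLpNormEssSup (f := w) (μ := cellMeasure T)] with x hx hw
  rw [enorm_mul, enorm_mul, mul_comm]
  rw [← eLpNorm_exponent_top] at hw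
  refine mul_le_mul' hw ?_
  refine mul_le_of_le_one_left zero_le ?_
  rw [Real.enorm_eq_ofReal (bubble_nonneg T x)]
  simpa using bubble_le_one T hx

/-- The supremum in the definition of the dual seminorm. -/
def dualSup (k : ℕ) (T : Simp n) (w : Pt n → ℝ) : ℝ≥0∞ :=
  ⨆ (ψ : MvPolynomial (Fin n) ℝ) (_ : ψ.totalDegree ≤ k)
    (_ : eLpNorm (peval ψ) 1 (cellMeasure T) = 1),
    ENNReal.ofReal |∫ x, bubble T x * peval ψ x * w x ∂(cellMeasure T)|

theorem totalDegree_l2Proj_le (T : Simp n) (k : ℕ) (w : Pt n → ℝ) :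
    (l2Proj T k w).totalDegree ≤ k := by
  rw [l2Proj]
  split_ifs with h
  · exact h.choose_spec.1
  · simp

/-- A polynomial is controlled by testing it with `b_T ψ`, `ψ` a polynomial. -/
theorem exists_supNorm_peval_le (hn : n ≠ 0) (k : ℕ) {σ : ℝ} (hσ : 0 < σ) :
    ∃ A : ℝ, 0 < A ∧ ∀ (T : Simp n) (x₀ : Pt n),
      Metric.closedBall x₀ (cellDiam T / σ) ⊆ cell T →
      ∀ q : MvPolynomial (Fin n) ℝ, q.totalDegree ≤ k →
        supNorm T (peval q) ≤ ENNReal.ofReal A * dualSup k T (peval q) := by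
  obtain ⟨A, hA, H⟩ := exists_cell_inverse_estimate hn k hσ
  refine ⟨A, hA, fun T x₀ hball q hq => ?_⟩
  obtain ⟨M, hM0, hM, hMJ, hMb⟩ := H T x₀ hball q hq
  have hh := cellDiam_pos hn T
  have hsup : supNorm T (peval q) ≤ ENNReal.ofReal M := by
    refine (eLpNorm_le_of_ae_bound (C := M) ?_).trans_eq (by simp)
    filter_upwards [ae_mem_cell T] with x hx using (hM x hx).1
  set J := ∫ x, |peval q x| ∂(cellMeasure T) with hJ
  have hJ0 : 0 ≤ J := integral_nonneg fun _ => abs_nonneg _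
  -- If `‖q‖_{L¹} = 0`, then `q` cannot be normalised, but `M` vanishes too. Otherwise test with `q
  -- / ‖q‖_{L¹}`.
  rcases hJ0.eq_or_lt with h0 | h0
  · have : M ≤ 0 := by
      rw [← h0, mul_zero] at hMJ
      exact nonpos_of_mul_nonpos_right hMJ (by positivity)
    refine hsup.trans ?_
    rw [ENNReal.ofReal_of_nonpos this]
    exact zero_le
  · set ψ : MvPolynomial (Fin n) ℝ := MvPolynomial.C J⁻¹ * q with hψ
    have hψx : ∀ x, peval ψ x = J⁻¹ * peval q x := fun x => by simp [peval, hψ]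
    have hdeg : ψ.totalDegree ≤ k :=
      (MvPolynomial.totalDegree_mul _ _).trans (by simpa using hq)
    have hone : eLpNorm (peval ψ) 1 (cellMeasure T) = 1 := by
      rw [eLpNorm_one_peval]
      simp only [hψx, abs_mul]
      rw [integral_const_mul, ← hJ, abs_of_pos (inv_pos.2 h0), inv_mul_cancel₀ h0.ne',
        ENNReal.ofReal_one]
    have hle : M ≤ A * ∫ x, bubble T x * peval ψ x * peval q x ∂(cellMeasure T) := by
      have e : ∫ x, bubble T x * peval ψ x * peval q x ∂(cellMeasure T) =
          J⁻¹ * ∫ x, bubble T x * peval q x * peval q x ∂(cellMeasure T) := by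
        rw [← integral_const_mul]
        refine integral_congr_ae (ae_of_all _ fun x => ?_)
        simp only [hψx]; ring
      rw [e, mul_left_comm, ← div_eq_inv_mul, le_div_iff₀ h0]
      exact hMb
    refine hsup.trans ((ENNReal.ofReal_le_ofReal hle).trans ?_)
    rw [ENNReal.ofReal_mul hA.le]
    refine mul_le_mul_right ?_ _
    refine (ENNReal.ofReal_le_ofReal (le_abs_self _)).trans ?_
    exact le_iSup₂_of_le ψ hdeg (le_iSup_of_le hone le_rfl)

/-! ### The mesh-dependent weights -/

/-- The argument of the logarithm is at least `2`, also when `minDiam 𝒯 = 0`, since then the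
quotient is `0`. -/
theorem one_le_logFactor {ε : ℝ} (hε : 0 < ε) (𝒯 : Finset (Simp n)) : 1 ≤ logFactor ε 𝒯 := by
  have h0 : 0 ≤ minDiam 𝒯 := Real.iInf_nonneg fun _ => Metric.diam_nonneg
  have h1 : 0 ≤ Real.log (2 + ε / minDiam 𝒯) :=
    Real.log_nonneg (by have : 0 ≤ ε / minDiam 𝒯 := by positivity
                        linarith)
  have h2 := abs_nonneg (Real.log ε)
  rw [logFactor]
  linarith

theorem alphaW_nonneg {ε : ℝ} (hε : 0 < ε) (𝒯 : Finset (Simp n)) (T : Simp n) :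
    0 ≤ alphaW ε 𝒯 T := by
  have := one_le_logFactor hε 𝒯
  exact le_min zero_le_one (by positivity)

/-- Each entry of the minimum serves one term: `α_T ≤ ℓ_h h_T² / ε` absorbs the diffusion term, and
`α_T ≤ 1 ≤ ℓ_h` the lower-order one. -/
theorem alphaW_mul_le {ε : ℝ} (hε : 0 < ε) (𝒯 : Finset (Simp n)) {T : Simp n}
    (hT : 0 < cellDiam T) {A B : ℝ} (hA : 0 ≤ A) (hB : 0 ≤ B) :
    alphaW ε 𝒯 T * (ε * A / cellDiam T ^ 2 + B) ≤ (A + B) * logFactor ε 𝒯 := by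
  have h1 := one_le_logFactor hε 𝒯
  have h2 : alphaW ε 𝒯 T ≤ 1 := min_le_left _ _
  have h3 : alphaW ε 𝒯 T * (ε / cellDiam T ^ 2) ≤ logFactor ε 𝒯 := by
    refine (mul_le_mul_of_nonneg_right (min_le_right _ _) (by positivity)).trans_eq ?_
    field_simp
  have h4 := mul_le_mul_of_nonneg_right h3 hA
  have h5 := mul_le_mul_of_nonneg_right (h2.trans h1) hB
  have e : alphaW ε 𝒯 T * (ε * A / cellDiam T ^ 2 + B) =
    alphaW ε 𝒯 T * (ε / cellDiam T ^ 2) * A + alphaW ε 𝒯 T * B := by ring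
  rw [e]
  linarith

theorem starSeminorm_eq (ε : ℝ) (𝒯 : Finset (Simp n)) (r : ℕ) (T : Simp n) (w : Pt n → ℝ) :
    starSeminorm ε 𝒯 r T w = ENNReal.ofReal (alphaW ε 𝒯 T) * dualSup (r - 1) T w := rfl

/-- Used in both directions, with the residual and the convective error exchanging the roles of `v`
and `w`. -/
theorem dualSup_le_of_integral_add {k : ℕ} {T : Simp n} {v w : Pt n → ℝ} {X : ℝ≥0∞}
    (h : ∀ ψ : MvPolynomial (Fin n) ℝ, ψ.totalDegree ≤ k →
      eLpNorm (peval ψ) 1 (cellMeasure T) = 1 →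
      ENNReal.ofReal |∫ x, bubble T x * peval ψ x * v x ∂(cellMeasure T) +
        ∫ x, bubble T x * peval ψ x * w x ∂(cellMeasure T)| ≤ X) :
    dualSup k T w ≤ X + dualSup k T v := by
  refine iSup₂_le fun ψ hψ => iSup_le fun hone => ?_
  set s := ∫ x, bubble T x * peval ψ x * v x ∂(cellMeasure T) with hs
  set t := ∫ x, bubble T x * peval ψ x * w x ∂(cellMeasure T)
  have h1 : |t| ≤ |s + t| + |s| := by
    have := abs_sub (s + t) s
    rwa [add_sub_cancel_left] at this
  refine (ENNReal.ofReal_le_ofReal h1).trans ?_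
  rw [ENNReal.ofReal_add (abs_nonneg _) (abs_nonneg _)]
  refine add_le_add (h ψ hψ hone) ?_
  exact le_iSup₂_of_le ψ hψ (le_iSup_of_le hone le_rfl)

theorem dualSup_le_supNorm (k : ℕ) (T : Simp n) (w : Pt n → ℝ) :
    dualSup k T w ≤ supNorm T w :=
  iSup₂_le fun ψ _ => iSup_le fun hone => by
    simpa [hone] using ofReal_abs_integral_bubble_le T ψ w

theorem dualSup_add_le (k : ℕ) {T : Simp n} {v w : Pt n → ℝ}
    (hv : Integrable v (cellMeasure T)) (hw : Integrable w (cellMeasure T)) :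
    dualSup k T (fun x => v x + w x) ≤ dualSup k T v + dualSup k T w := by
  refine iSup₂_le fun ψ hψ => iSup_le fun hone => ?_
  have hc : ContinuousOn (fun x => bubble T x * peval ψ x) (cell T) :=
    ((continuous_bubble T).mul (continuous_peval ψ)).continuousOn
  have i1 : Integrable (fun x => bubble T x * peval ψ x * v x) (cellMeasure T) := by
    simpa only [mul_comm] using Integrable.mul_continuousOn_cell hv hc
  have i2 : Integrable (fun x => bubble T x * peval ψ x * w x) (cellMeasure T) := by
    simpa only [mul_comm] using Integrable.mul_continuousOn_cell hw hc
  simp only [mul_add]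
  rw [integral_add i1 i2]
  refine (ENNReal.ofReal_le_ofReal (abs_add_le _ _)).trans ?_
  rw [ENNReal.ofReal_add (abs_nonneg _) (abs_nonneg _)]
  exact add_le_add (le_iSup₂_of_le ψ hψ (le_iSup_of_le hone le_rfl))
    (le_iSup₂_of_le ψ hψ (le_iSup_of_le hone le_rfl))

theorem ae_abs_le_toReal_supNorm {T : Simp n} {w : Pt n → ℝ} (hw : supNorm T w ≠ ⊤) :
    ∀ᵐ x ∂(cellMeasure T), |w x| ≤ (supNorm T w).toReal := by
  filter_upwards [ae_le_eLpNormEssSup (f := w) (μ := cellMeasure T)] with x hx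
  rw [← eLpNorm_exponent_top] at hx
  rw [← Real.norm_eq_abs, ← toReal_enorm]
  exact ENNReal.toReal_mono hw hx

theorem CellRegular.ofReal_abs_integral_bubble_le {Ω : Set (Pt n)} {T : Simp n}
    {a : Pt n → Pt n} {b f u : Pt n → ℝ} {g : Pt n → Pt n} {uh : Pt n → ℝ}
    {p : MvPolynomial (Fin n) ℝ} {Ca : ℝ} (h : CellRegular Ω T a b f u g uh p Ca) {ε : ℝ}
    (hε : 0 < ε) (hu : IsWeakSolution Ω ε a b f u g) (hh : 0 < cellDiam T) {A : ℝ} (hA : 0 ≤ A)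
    (hCa : 0 ≤ Ca) (he : supNorm T (fun x => u x - uh x) ≠ ⊤) {ψ : MvPolynomial (Fin n) ℝ}
    (hone : eLpNorm (peval ψ) 1 (cellMeasure T) = 1)
    (hψ : ∀ c : ℝ, 0 < c → cellDiam T ^ 2 * ∫ x, |lap (testFn c T ψ) x| ∂(cellMeasure T) ≤
      A * ∫ x, |peval ψ x| ∂(cellMeasure T)) :
    ENNReal.ofReal |∫ x, bubble T x * peval ψ x * residual ε a b f uh x ∂(cellMeasure T) +
        ∫ x, bubble T x * peval ψ x * convError a g uh x ∂(cellMeasure T)| ≤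
      ENNReal.ofReal (ε * A / cellDiam T ^ 2 + 2 * Ca) * supNorm T (fun x => u x - uh x) := by
  have h1 := h.abs_integral_bubble_le hε hu hh ENNReal.toReal_nonneg
    (ae_abs_le_toReal_supNorm he) ψ hψ
  have hJ : ∫ x, |peval ψ x| ∂(cellMeasure T) = 1 := by
    rw [eLpNorm_one_peval, ENNReal.ofReal_eq_one] at hone
    exact hone
  rw [hJ, mul_one] at h1
  refine (ENNReal.ofReal_le_ofReal h1).trans_eq ?_
  rw [ENNReal.ofReal_mul (by positivity), ENNReal.ofReal_toReal he]

end

end ConvDiff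

/-! ### Proof of the two estimates -/

open ConvDiff MeasureTheory in
theorem corollary3p3 (n : ℕ) (hn : n = 2 ∨ n = 3) (r : ℕ) (hr : 1 ≤ r)
    (Ω : Set (ConvDiff.Pt n)) (hΩ : ConvDiff.IsPolyhedralDomain Ω)
    (a : ConvDiff.Pt n → ConvDiff.Pt n) (b f : ConvDiff.Pt n → ℝ)
    (ha : ContDiffOn ℝ 1 a (closure Ω)) (hb : ContinuousOn b (closure Ω))
    (hf : ContinuousOn f (closure Ω))
    (ha_ne : ∀ x ∈ closure Ω, a x ≠ 0) (hb_nonneg : ∀ x ∈ closure Ω, 0 ≤ b x)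
    (hab : ∀ x ∈ Ω, 0 ≤ b x + 1 / 2 * ConvDiff.divg a x)
    (σ : ℝ) (hσ : 0 < σ) :
    ∃ C : ℝ, 0 < C ∧
      ∀ ε : ℝ, 0 < ε → ε ≤ 1 →
      ∀ 𝒯 : Finset (ConvDiff.Simp n), ConvDiff.IsMesh Ω 𝒯 → ConvDiff.ShapeRegular 𝒯 σ →
      ∀ (u : ConvDiff.Pt n → ℝ) (g : ConvDiff.Pt n → ConvDiff.Pt n),
        ConvDiff.IsWeakSolution Ω ε a b f u g →
      ∀ uh : ConvDiff.Pt n → ℝ, ConvDiff.IsFEFunction Ω 𝒯 r uh →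
      ∀ T ∈ 𝒯,
        ENNReal.ofReal (ConvDiff.alphaW ε 𝒯 T) *
            ConvDiff.supNorm T (ConvDiff.residual ε a b f uh) ≤
          ENNReal.ofReal C *
            (ENNReal.ofReal (ConvDiff.logFactor ε 𝒯) * ConvDiff.supNorm T (fun x => u x - uh x) +
              ConvDiff.starSeminorm ε 𝒯 r T (ConvDiff.convError a g uh) +
              ENNReal.ofReal (ConvDiff.alphaW ε 𝒯 T) *
                ConvDiff.supNorm T (fun x => ConvDiff.residual ε a b f uh x -
                  ConvDiff.peval
                    (ConvDiff.l2Proj T (r - 1) (ConvDiff.residual ε a b f uh)) x)) ∧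
        ConvDiff.starSeminorm ε 𝒯 r T (ConvDiff.convError a g uh) ≤
          ENNReal.ofReal C *
            (ENNReal.ofReal (ConvDiff.logFactor ε 𝒯) * ConvDiff.supNorm T (fun x => u x - uh x) +
              ENNReal.ofReal (ConvDiff.alphaW ε 𝒯 T) *
                ConvDiff.supNorm T (ConvDiff.residual ε a b f uh)) := by
  have hn0 : n ≠ 0 := by omega
  have hK : IsCompact (closure Ω) := hΩ.bounded.isCompact_closure
  obtain ⟨Cd, hCd⟩ := exists_bound_fderiv hΩ.isOpen hK ha
  obtain ⟨Cb, hCb⟩ := hK.exists_bound_of_continuousOn hb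
  obtain ⟨A₀, hA₀, H₀⟩ := exists_integral_abs_lap_testFn_le hn0 (r - 1) hσ
  obtain ⟨A₁, hA₁, H₁⟩ := exists_supNorm_peval_le hn0 (r - 1) hσ
  set Ca := max (n * Cd) (max Cb 0) with hCa
  have hCa0 : 0 ≤ Ca := (le_max_right _ _).trans (le_max_right _ _)
  -- `A₀ + 2 * Ca` comes from the error identity; the extra `1` gives `1 ≤ G`, so that `G` also
  -- dominates the unit coefficients of the other terms. In the final constant, `A₁` comes from the
  -- bound for the projection and `+ 1` from the triangle inequality.
  set G := A₀ + 2 * Ca + 1 with hG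
  have hG1 : 1 ≤ G := by rw [hG]; linarith
  refine ⟨(A₁ + 1) * G, by positivity, fun ε hε _ 𝒯 h𝒯 hreg u g hu uh huh T hT => ?_⟩
  obtain ⟨x₀, hball⟩ := hreg T hT
  obtain ⟨p, -, hp⟩ := huh.poly T hT
  have hh := cellDiam_pos hn0 T
  have hcell : cell T ⊆ closure Ω := by
    rw [← h𝒯.cover]
    exact Set.subset_biUnion_of_mem (u := fun T => cell T) hT
  have hreg : CellRegular Ω T a b f u g uh p Ca :=
    { isOpen := hΩ.isOpen
      isBounded := hΩ.bounded
      interior_subset := h𝒯.interior_subset T hT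
      contDiffOn := ha.mono subset_closure
      cont_a := ha.continuousOn.mono hcell
      cont_b := hb.mono hcell
      cont_f := hf.mono hcell
      divg_le := fun x hx => (abs_divg_le a x).trans
        ((mul_le_mul_of_nonneg_left (hCd x hx) (Nat.cast_nonneg _)).trans (le_max_left _ _))
      b_le := fun x hx => (hCb x (hcell hx)).trans ((le_max_left _ _).trans (le_max_right _ _))
      isH10 := hu.isH10
      eq_poly := hp }
  have hℓ := one_le_logFactor hε 𝒯
  have hα := alphaW_nonneg hε 𝒯 T
  rw [starSeminorm_eq]
  set R := residual ε a b f uh with hR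
  set W := convError a g uh with hW
  set q := l2Proj T (r - 1) R with hq
  set α := ENNReal.ofReal (alphaW ε 𝒯 T) with hα'
  set L := ENNReal.ofReal (logFactor ε 𝒯) with hL
  set Se := supNorm T (fun x => u x - uh x) with hSe
  set Sq := supNorm T (fun x => R x - peval q x) with hSq
  -- If the error is unbounded on `T`, both right-hand sides are infinite, because `ℓ_h` and the
  -- constant are positive.
  by_cases htop : Se = ⊤
  · have hLpos : L ≠ 0 := by
      rw [hL, Ne, ENNReal.ofReal_eq_zero, not_le]; linarith
    have hCpos : ENNReal.ofReal ((A₁ + 1) * G) ≠ 0 := by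
      rw [Ne, ENNReal.ofReal_eq_zero, not_le]; positivity
    simp [htop, ENNReal.mul_top hLpos, ENNReal.mul_top hCpos]
  set κ := ENNReal.ofReal (ε * A₀ / cellDiam T ^ 2 + 2 * Ca) with hκ
  have hακ : α * κ ≤ ENNReal.ofReal G * L := by
    rw [hα', hκ, hL, ← ENNReal.ofReal_mul hα, ← ENNReal.ofReal_mul (by linarith)]
    refine ENNReal.ofReal_le_ofReal ((alphaW_mul_le hε 𝒯 hh hA₀.le (by positivity)).trans ?_)
    exact mul_le_mul_of_nonneg_right (by linarith) (by linarith)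
  have hmain : ∀ ψ : MvPolynomial (Fin n) ℝ, ψ.totalDegree ≤ r - 1 →
      eLpNorm (peval ψ) 1 (cellMeasure T) = 1 →
      ENNReal.ofReal |∫ x, bubble T x * peval ψ x * R x ∂(cellMeasure T) +
        ∫ x, bubble T x * peval ψ x * W x ∂(cellMeasure T)| ≤ κ * Se := fun ψ hψ hone =>
    hreg.ofReal_abs_integral_bubble_le hε hu hh hA₀.le hCa0 htop hone (H₀ T x₀ hball ψ hψ)
  have hWle : dualSup (r - 1) T W ≤ κ * Se + dualSup (r - 1) T R :=
    dualSup_le_of_integral_add hmain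
  have hRle : dualSup (r - 1) T R ≤ κ * Se + dualSup (r - 1) T W :=
    dualSup_le_of_integral_add fun ψ hψ hone => by
      rw [add_comm]; exact hmain ψ hψ hone
  have hRint := hreg.integrable_residual ε
  have hqint := integrable_cell_of_continuous T (continuous_peval q)
  -- Split `q = R + (q - R)`; the second part is bounded by its sup norm, since `0 ≤ b_T ≤ 1`.
  have hqle : dualSup (r - 1) T (peval q) ≤ dualSup (r - 1) T R + Sq := by
    have h1 := dualSup_add_le (r - 1) hRint (hqint.sub hRint)
    have e1 : (fun x => R x + (peval q - R) x) = peval q := by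
      funext x; simp
    have e2 : supNorm T (peval q - R) = Sq := eLpNorm_sub_comm _ _ _ _
    rw [e1] at h1
    exact h1.trans (add_le_add le_rfl ((dualSup_le_supNorm _ _ _).trans_eq e2))
  have hSR : supNorm T R ≤ Sq + supNorm T (peval q) := by
    have h1 := eLpNorm_add_le (p := ⊤) (hRint.sub hqint).aestronglyMeasurable
      hqint.aestronglyMeasurable le_top
    rwa [sub_add_cancel] at h1
  have hSq' := H₁ T x₀ hball q (totalDegree_l2Proj_le T (r - 1) R)
  set D := dualSup (r - 1) T W with hD
  have hG1' : 1 ≤ ENNReal.ofReal G := by simpa using hG1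
  have hC : ENNReal.ofReal ((A₁ + 1) * G) = (ENNReal.ofReal A₁ + 1) * ENNReal.ofReal G := by
    rw [ENNReal.ofReal_mul (by positivity), ENNReal.ofReal_add hA₁.le zero_le_one,
      ENNReal.ofReal_one]
  rw [hC]
  set A := ENNReal.ofReal A₁ with hA
  set Γ := ENNReal.ofReal G with hΓ
  constructor
  · calc α * supNorm T R ≤ α * (Sq + A * (κ * Se + D + Sq)) := by
          gcongr
          refine hSR.trans (add_le_add le_rfl (hSq'.trans ?_))
          gcongr
          exact hqle.trans (add_le_add hRle le_rfl)
      _ = A * ((α * κ) * Se) + A * (1 * (α * D)) + (A + 1) * (1 * (α * Sq)) := by ring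
      _ ≤ (A + 1) * ((Γ * L) * Se) + (A + 1) * (Γ * (α * D)) + (A + 1) * (Γ * (α * Sq)) := by
          gcongr
          · exact le_self_add
          · exact le_self_add
      _ = _ := by ring
  · calc α * D ≤ α * (κ * Se + supNorm T R) := by
          gcongr
          exact hWle.trans (add_le_add le_rfl (dualSup_le_supNorm _ _ _))
      _ = 1 * ((α * κ) * Se + 1 * (α * supNorm T R)) := by ring
      _ ≤ (A + 1) * ((Γ * L) * Se + Γ * (α * supNorm T R)) := by
          gcongr
          exact le_add_self
      _ = _ := by ring
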